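/- Let $\mathcal R$ be the cone of distance matrices, i.e. of infinite real matrices $r=(r_{i,j})_{i,j\ge 1}$ with $r_{i,i}=0$, $r_{i,j}=r_{j,i}\ge 0$ and $r_{i,j}\le r_{i,k}+r_{k,j}$ for all $i,j,k$, with the topology of entrywise convergence. The group $S_\infty$ of all finite permutations of $\{1,2,\dots\}$ acts on $\mathcal R$ by simultaneous permutations of rows and columns. A metric triple $T=(X,\rho,\mu)$ is a complete separable metric space $(X,\rho)$ with a Borel probability measure $\mu$; its matrix distribution $D_T$ is the law on $\mathcal R$ of the random matrix $(\rho(x_i,x_j))_{i,j\ge 1}$, where $x_1,x_2,\dots$ are independent points of $X$ with law $\mu$. Let $D$ be a Borel probability measure on $\mathcal R$ that is invariant and ergodic under the action of $S_\infty$. 1) The measure $D$ is the matrix distribution of some metric triple if and only if for every $\varepsilon>0$ there exists an integer $N=N(\varepsilon)$ such that $$D\Bigl\{r\in\mathcal R:\ \lim_{n\to\infty}\frac{|\{j: 1\le j\le n,\ \min_{1\le i\le N} r_{i,j}<\varepsilon\}|}{n}>1-\varepsilon\Bigr\}>1-\varepsilon$$ (the condition on $r$ includes the existence of the limit). 2)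 The measure $D$ is the matrix distribution of some metric triple $(X,\rho,\mu)$ with $(X,\rho)$ compact if and only if for every $\varepsilon>0$ there exists an integer $N=N(\varepsilon)$ such that $$D\Bigl\{r\in\mathcal R:\ \min_{1\le i\le N} r_{i,j}<\varepsilon\ \text{ for all } j>N\Bigr\}>1-\varepsilon.$$ In both parts one may equivalently require in addition that $\mu$ be nondegenerate, i.e. positive on every nonempty open set. -/

import Mathlib

open MeasureTheory Filter Topology

universe u

/-- The cone of distance matrices: infinite real matrices, indexed by `ℕ`, that are the matrices of
semimetrics on `ℕ` (zeros off the diagonal are allowed). -/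
def distanceCone : Set (ℕ → ℕ → ℝ) :=
  {r | (∀ i, r i i = 0) ∧ (∀ i j, 0 ≤ r i j) ∧ (∀ i j, r i j = r j i) ∧
    ∀ i j k, r i j ≤ r i k + r k j}

/-- Distance matrices, with the topology of entrywise convergence and its Borel `σ`-algebra (both
inherited from `ℕ → ℕ → ℝ`). -/
abbrev DistanceMatrix : Type := ↥distanceCone

theorem borelSpace_distanceMatrix : BorelSpace DistanceMatrix := inferInstance

/-- The infinite symmetric group: the permutations of `ℕ` that move only finitely many elements. -/
def infiniteSymmetricGroup : Subgroup (Equiv.Perm ℕ) where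
  carrier := {g | {i | g i ≠ i}.Finite}
  mul_mem' := by
    intro a b ha hb
    refine (ha.union hb).subset ?_
    intro i hi
    by_contra h
    simp only [Set.mem_union, Set.mem_ofPred_eq, not_or, not_not] at h
    exact hi (by rw [Equiv.Perm.mul_apply, h.2, h.1])
  one_mem' := by simp
  inv_mem' := by
    intro a ha
    refine Set.Finite.subset ha ?_
    intro i hi h
    exact hi (by rw [Equiv.Perm.inv_eq_iff_eq]; exact h.symm)

/-- The action on distance matrices by simultaneous permutations of rows and columns. -/
instance : MulAction infiniteSymmetricGroup DistanceMatrix where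
  smul g r := ⟨fun i j => r.1 ((g : Equiv.Perm ℕ)⁻¹ i) ((g : Equiv.Perm ℕ)⁻¹ j),
    fun _ => r.2.1 _, fun _ _ => r.2.2.1 _ _, fun _ _ => r.2.2.2.1 _ _,
    fun _ _ _ => r.2.2.2.2 _ _ _⟩
  one_smul _ := rfl
  mul_smul g h r := by
    apply Subtype.ext
    funext i j
    change r.1 (((g : Equiv.Perm ℕ) * h)⁻¹ i) (((g : Equiv.Perm ℕ) * h)⁻¹ j) = _
    rw [mul_inv_rev]
    rfl

/-- A metric triple `(X, ρ, μ)`: a complete separable metric space with a Borel probability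
measure. -/
structure MetricTriple where
  X : Type u
  [metric : MetricSpace X]
  [complete : CompleteSpace X]
  [separable : TopologicalSpace.SeparableSpace X]
  [measurable : MeasurableSpace X]
  [borel : BorelSpace X]
  μ : Measure X
  [prob : IsProbabilityMeasure μ]

namespace MetricTriple

attribute [instance] metric complete separable measurable borel prob

/-- The map sending a sequence of points to its matrix of pairwise distances. -/
def distMap (T : MetricTriple.{u}) (x : ℕ → T.X) : DistanceMatrix :=
  ⟨fun i j => dist (x i) (x j), fun _ => dist_self _, fun _ _ => dist_nonneg,
    fun _ _ => dist_comm _ _, fun _ _ _ => dist_triangle _ _ _⟩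

theorem measurable_distMap (T : MetricTriple.{u}) : Measurable T.distMap := by
  have : SecondCountableTopology T.X := UniformSpace.secondCountable_of_separable T.X
  refine Measurable.subtype_mk (measurable_pi_lambda _ fun i => measurable_pi_lambda _ fun j => ?_)
  exact (measurable_pi_apply i).dist (measurable_pi_apply j)

/-- The matrix distribution of a metric triple: the law of the distance matrix of a sequence of
independent points with common law `μ`. -/
noncomputable def matrixDistribution (T : MetricTriple.{u}) : Measure DistanceMatrix :=
  (Measure.infinitePi fun _ : ℕ => T.μ).map T.distMap

end MetricTriple

open Classical in
/-- The proportion, among the first `n` columns, of those columns `j` such that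
`r i j < ε` for one of the first `N` indices `i`. -/
noncomputable def coveredFraction (ε : ℝ) (N : ℕ) (r : DistanceMatrix) (n : ℕ) : ℝ :=
  (((Finset.range n).filter fun j => ∃ i < N, r.1 i j < ε).card : ℝ) / n

/-- For every `ε > 0` there is an `N` such that, with probability greater than `1 - ε`, the
asymptotic fraction of the columns that are within `ε` of the first `N` points exists and is
greater than `1 - ε`. -/
def MostColumnsCovered (D : Measure DistanceMatrix) : Prop :=
  ∀ ε : ℝ, 0 < ε → ∃ N : ℕ,
    1 - ε < D.real {r | ∃ L : ℝ, Tendsto (coveredFraction ε N r) atTop (𝓝 L) ∧ 1 - ε < L}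

/-- For every `ε > 0` there is an `N` such that, with probability greater than `1 - ε`, all the
points after the first `N` are within `ε` of the first `N` points. -/
def AllColumnsCovered (D : Measure DistanceMatrix) : Prop :=
  ∀ ε : ℝ, 0 < ε → ∃ N : ℕ,
    1 - ε < D.real {r | ∀ j, N ≤ j → ∃ i < N, r.1 i j < ε}

/-! The forward implications are laws of large numbers. For an independent sequence, the set of
points within `ε` of the first `N` terms grows to full measure as `N → ∞`
(`MetricTriple.ae_measure_iUnion_coveredSet`), and the frequency of terms falling in it tends to its
measure (`MetricTriple.ae_tendsto_coveredFraction`). In a compact space, finitely many terms are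
`ε`-dense among all terms.

Conversely, the triple is read off from one typical matrix `r`. Invariance and ergodicity make
blocks along disjoint index sets uncorrelated (`integral_block_mul_block`): the Cesàro means of a
function over disjoint blocks converge in `L²` to an invariant, hence constant, limit. So averages
of a bounded test over all tuples from the first `n` indices have variance `O(1/n)` and converge
almost surely along squares to the `D`-mean (`ae_tendsto_blockAverage`). Countably many
trigonometric tests determine a law, so almost every `r` determines `D`.

Complete the index set under the semimetric `r`. The covering condition makes the empirical measures
of the index points tight, so they accumulate at some `μ`. A block average is the integral of the
test against a power of the empirical measure; in the limit, the integrals against powers of `μ` are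
those of `D`, and the matrix distribution is `D`. Under the stronger covering condition `r` is
totally bounded and the completion is compact. Nondegeneracy costs nothing: restrict `μ` to its
support. -/

/-! ### Blocks of distance matrices and exchangeability. -/

/-- The submatrix of a distance matrix with rows and columns indexed along `j`. -/
def DistanceMatrix.block {ι : Type*} (j : ι → ℕ) (r : DistanceMatrix) : ι → ι → ℝ :=
  fun a b => r.1 (j a) (j b)

theorem DistanceMatrix.measurable_entry (i j : ℕ) :
    Measurable fun r : DistanceMatrix => r.1 i j :=
  (measurable_pi_apply j).comp ((measurable_pi_apply i).comp measurable_subtype_coe)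

theorem DistanceMatrix.measurable_block {ι : Type*} (j : ι → ℕ) :
    Measurable (DistanceMatrix.block j) :=
  measurable_pi_lambda _ fun _ => measurable_pi_lambda _ fun _ =>
    DistanceMatrix.measurable_entry _ _

theorem DistanceMatrix.block_inv_smul {ι : Type*} (g : infiniteSymmetricGroup) (j : ι → ℕ)
    (r : DistanceMatrix) :
    block j (g⁻¹ • r) = block (fun a => (g : Equiv.Perm ℕ) (j a)) r := by
  funext a b
  change r.1 (((g⁻¹ : infiniteSymmetricGroup) : Equiv.Perm ℕ)⁻¹ (j a))
    (((g⁻¹ : infiniteSymmetricGroup) : Equiv.Perm ℕ)⁻¹ (j b)) = _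
  simp [block]

theorem DistanceMatrix.block_smul {ι : Type*} (g : infiniteSymmetricGroup) (j : ι → ℕ)
    (r : DistanceMatrix) :
    block j (g • r) = block (fun a => (g : Equiv.Perm ℕ)⁻¹ (j a)) r := rfl

instance : MeasurableConstSMul infiniteSymmetricGroup DistanceMatrix where
  measurable_const_smul _ := Measurable.subtype_mk <|
    measurable_pi_lambda _ fun _ => measurable_pi_lambda _ fun _ =>
      DistanceMatrix.measurable_entry _ _

/-- Finite permutations act transitively on injective tuples. -/
theorem exists_infiniteSymmetricGroup_apply_eq {ι : Type*} [Finite ι] {j j' : ι → ℕ}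
    (hj : Function.Injective j) (hj' : Function.Injective j') :
    ∃ g : infiniteSymmetricGroup, ∀ a, (g : Equiv.Perm ℕ) (j a) = j' a := by
  classical
  obtain ⟨M, hM⟩ : ∃ M, ∀ a, j a < M ∧ j' a < M := by
    obtain ⟨M, hM⟩ := (Set.finite_range j).bddAbove
    obtain ⟨M', hM'⟩ := (Set.finite_range j').bddAbove
    refine ⟨max M M' + 1, fun a => ⟨?_, ?_⟩⟩
    · have := hM (Set.mem_range_self a); omega
    · have := hM' (Set.mem_range_self a); omega
  let J : ι → Fin M := fun a => ⟨j a, (hM a).1⟩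
  let J' : ι → Fin M := fun a => ⟨j' a, (hM a).2⟩
  have hJ : Function.Injective J := fun a b h => hj (congrArg Fin.val h)
  have hJ' : Function.Injective J' := fun a b h => hj' (congrArg Fin.val h)
  let e : {x // x ∈ Set.range J} ≃ {x // x ∈ Set.range J'} :=
    (Equiv.ofInjective J hJ).symm.trans (Equiv.ofInjective J' hJ')
  let s : Equiv.Perm (Fin M) := e.extendSubtype
  have hs : ∀ a, s (J a) = J' a := by
    intro a
    have h := e.extendSubtype_apply_of_mem (J a) ⟨a, rfl⟩
    rw [show s (J a) = _ from h]
    simp only [e, Equiv.trans_apply]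
    have : (Equiv.ofInjective J hJ).symm ⟨J a, ⟨a, rfl⟩⟩ = a := by
      rw [Equiv.symm_apply_eq]; rfl
    rw [this]; rfl
  let g : Equiv.Perm ℕ := s.viaFintypeEmbedding Fin.valEmbedding
  refine ⟨⟨g, ?_⟩, fun a => ?_⟩
  · refine (Set.finite_range (Fin.valEmbedding : Fin M ↪ ℕ)).subset ?_
    intro i hi
    by_contra h
    exact hi (Equiv.Perm.viaFintypeEmbedding_apply_notMem_range _ _ h)
  · have := s.viaFintypeEmbedding_apply_image Fin.valEmbedding (J a)
    change g (Fin.valEmbedding (J a)) = _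
    rw [this, hs]
    rfl

/-- Some finite permutation carries `j` to `j'`, and it preserves `D`. It acts as a measurable
embedding, so `G` may be arbitrary. -/
theorem integral_block_eq_of_injective (D : Measure DistanceMatrix)
    [SMulInvariantMeasure infiniteSymmetricGroup DistanceMatrix D] {ι : Type*} [Finite ι]
    {j j' : ι → ℕ} (hj : Function.Injective j) (hj' : Function.Injective j')
    (G : (ι → ι → ℝ) → ℝ) :
    ∫ r, G (r.block j) ∂D = ∫ r, G (r.block j') ∂D := by
  obtain ⟨g, hg⟩ := exists_infiniteSymmetricGroup_apply_eq hj hj'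
  have h := (measurePreserving_smul g⁻¹ D).integral_comp
    (measurableEmbedding_const_smul g⁻¹) (fun r => G (r.block j))
  rw [← h]
  simp_rw [DistanceMatrix.block_inv_smul, hg]

/-! ### Cesàro means in Hilbert space. -/

section Hilbert

variable {H : Type*} [NormedAddCommGroup H] [InnerProductSpace ℝ H]

theorem inner_sum_range_of_gram {y : ℕ → H} {β γ : ℝ} (hy : ∀ m, inner ℝ (y m) (y m) = γ)
    (hyy : ∀ m l, m ≠ l → inner ℝ (y m) (y l) = β) {n p : ℕ} (h : n ≤ p) :
    inner ℝ (∑ m ∈ Finset.range n, y m) (∑ l ∈ Finset.range p, y l)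
      = n * p * β + n * (γ - β) := by
  have h1 : ∀ m l, inner ℝ (y m) (y l) = β + if m = l then γ - β else 0 := by
    intro m l
    by_cases hml : m = l
    · subst hml; rw [hy]; simp
    · simp [hml, hyy m l hml]
  rw [sum_inner]
  simp_rw [inner_sum, h1, Finset.sum_add_distrib]
  simp only [Finset.sum_const, Finset.card_range, nsmul_eq_mul, Finset.sum_ite_eq, Finset.mem_range]
  rw [Finset.sum_congr rfl (g := fun _ => γ - β)]
  · simp; ring
  · intro m hm
    rw [Finset.mem_range] at hm
    simp [lt_of_lt_of_le hm h]

/-- Cesàro means of vectors with constant pairwise inner products converge. -/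
theorem exists_tendsto_cesaro_of_gram [CompleteSpace H] {y : ℕ → H} {β γ : ℝ}
    (hy : ∀ m, inner ℝ (y m) (y m) = γ) (hyy : ∀ m l, m ≠ l → inner ℝ (y m) (y l) = β) :
    ∃ V : H, Tendsto (fun n : ℕ => ((n : ℝ) + 1)⁻¹ • ∑ m ∈ Finset.range (n + 1), y m) atTop (𝓝 V) ∧
      inner ℝ V V = β := by
  set A : ℕ → H := fun n : ℕ => ((n : ℝ) + 1)⁻¹ • ∑ m ∈ Finset.range (n + 1), y m with hA
  have hin : ∀ n p, n ≤ p → inner ℝ (A n) (A p) = β + (γ - β) * ((p : ℝ) + 1)⁻¹ := by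
    intro n p hnp
    have := inner_sum_range_of_gram hy hyy (Nat.succ_le_succ hnp)
    simp only [Nat.succ_eq_add_one] at this
    simp only [hA, real_inner_smul_left, real_inner_smul_right, this]
    push_cast
    field_simp
  -- By `hin` the left side equals `(γ - β) * (1 / (n + 1) - 1 / (p + 1))`.
  have hd : ∀ n p, n ≤ p → ‖A n - A p‖ ^ 2 ≤ |γ - β| * ((n : ℝ) + 1)⁻¹ := by
    intro n p hnp
    rw [← real_inner_self_eq_norm_sq, inner_sub_left, inner_sub_right, inner_sub_right,
      hin n n le_rfl, hin n p hnp, real_inner_comm, hin n p hnp, hin p p le_rfl]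
    have h0 : (0:ℝ) ≤ ((p : ℝ) + 1)⁻¹ := by positivity
    have h1 : ((p : ℝ) + 1)⁻¹ ≤ ((n : ℝ) + 1)⁻¹ := by gcongr
    have h2 := le_abs_self (γ - β)
    nlinarith [mul_nonneg (sub_nonneg.2 h2) (sub_nonneg.2 h1), mul_nonneg (abs_nonneg (γ - β)) h0]
  have hlim : Tendsto (fun n : ℕ => ((n : ℝ) + 1)⁻¹) atTop (𝓝 0) := by
    simpa [one_div] using tendsto_one_div_add_atTop_nhds_zero_nat (𝕜 := ℝ)
  have hc : CauchySeq A := by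
    refine cauchySeq_of_le_tendsto_0' (fun n => Real.sqrt (|γ - β| * ((n : ℝ) + 1)⁻¹)) ?_ ?_
    · intro n p hnp
      rw [dist_eq_norm]
      exact Real.le_sqrt_of_sq_le (hd n p hnp)
    · have := (hlim.const_mul |γ - β|).sqrt
      simpa using this
  obtain ⟨V, hV⟩ := cauchySeq_tendsto_of_complete hc
  refine ⟨V, hV, tendsto_nhds_unique (hV.inner hV) ?_⟩
  have := (hlim.const_mul (γ - β)).const_add β
  simp only [mul_zero, add_zero] at this
  exact this.congr fun n => (hin n n le_rfl).symm

/-- An isometric map that moves only finitely many terms of a sequence fixes the limit of its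
Cesàro means. -/
theorem map_eq_of_tendsto_cesaro {y : ℕ → H} {V : H} (U : H → H) (hU : Isometry U)
    (hUs : ∀ (c : ℝ) (s : Finset ℕ), U (c • ∑ m ∈ s, y m) = c • ∑ m ∈ s, U (y m))
    {M : ℕ} (hM : ∀ m, M ≤ m → U (y m) = y m)
    (hV : Tendsto (fun n : ℕ => ((n : ℝ) + 1)⁻¹ • ∑ m ∈ Finset.range (n + 1), y m) atTop (𝓝 V)) :
    U V = V := by
  have h1 := (hU.continuous.tendsto V).comp hV
  refine tendsto_nhds_unique h1 ?_
  have hlim : Tendsto (fun n : ℕ => ((n : ℝ) + 1)⁻¹) atTop (𝓝 0) := by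
    simpa [one_div] using tendsto_one_div_add_atTop_nhds_zero_nat (𝕜 := ℝ)
  have h2 := hV.add (hlim.smul_const (∑ m ∈ Finset.range M, (U (y m) - y m)))
  rw [zero_smul, add_zero] at h2
  refine h2.congr' ?_
  filter_upwards [eventually_ge_atTop M] with n hn
  simp only [Function.comp_apply]
  rw [hUs, ← smul_add]
  congr 1
  -- Only the first `M` terms move, so the two sums differ by a fixed vector, which the factor `1 /
  -- (n + 1)` kills.
  have h3 : ∑ m ∈ Finset.range M, (U (y m) - y m) = ∑ m ∈ Finset.range (n + 1), (U (y m) - y m) := by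
    refine Finset.sum_subset (Finset.range_mono (by omega)) ?_
    intro m _ hm
    rw [Finset.mem_range, not_lt] at hm
    rw [hM m hm, sub_self]
  rw [h3, Finset.sum_sub_distrib]
  abel

end Hilbert

/-- Every preimage of a measurable set is almost invariant, hence null or conull; countably many
sets separating the reals then pin down one value. -/
theorem ErgodicSMul.exists_ae_eq_const {Γ α : Type*} [Group Γ] [MulAction Γ α] [MeasurableSpace α]
    {μ : Measure α} [ErgodicSMul Γ α μ] {f : α → ℝ} (hf : AEStronglyMeasurable f μ)
    (h : ∀ g : Γ, (fun x => f (g • x)) =ᵐ[μ] f) : ∃ c, f =ᵐ[μ] fun _ => c := by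
  refine exists_eventuallyEq_const_of_forall_separating MeasurableSet fun U hU => ?_
  have h1 : EventuallyConst (f ⁻¹' U) (ae μ) := by
    refine MeasureTheory.aeconst_of_forall_preimage_smul_ae_eq Γ
      (hf.aemeasurable.nullMeasurable hU) fun g => ?_
    refine ((h g).mono fun x hx => ?_).set_eq
    exact iff_of_eq (congrArg (· ∈ U) hx)
  rwa [eventuallyConst_set] at h1

/-! ### Ergodicity decorrelates disjoint blocks. -/

section Dissociated

variable (D : Measure DistanceMatrix) {ι : Type*} [Finite ι]

/-- Disjointness of the two tuples is encoded as injectivity on `ι ⊕ ι`, so the product is a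
function of a single block. -/
theorem integral_block_mul_block_eq_of_injective
    [SMulInvariantMeasure infiniteSymmetricGroup DistanceMatrix D] {j₁ j₂ j₁' j₂' : ι → ℕ}
    (h : Function.Injective (Sum.elim j₁ j₂)) (h' : Function.Injective (Sum.elim j₁' j₂'))
    (G : (ι → ι → ℝ) → ℝ) :
    ∫ r, G (r.block j₁) * G (r.block j₂) ∂D = ∫ r, G (r.block j₁') * G (r.block j₂') ∂D :=
  integral_block_eq_of_injective D h h' fun M =>
    G (fun a b => M (Sum.inl a) (Sum.inl b)) * G (fun a b => M (Sum.inr a) (Sum.inr b))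

/-- The blocks of an ergodic random distance matrix along disjoint index sets are uncorrelated. -/
theorem integral_block_mul_block [IsProbabilityMeasure D]
    [ErgodicSMul infiniteSymmetricGroup DistanceMatrix D] {j₁ j₂ : ι → ℕ}
    (h : Function.Injective (Sum.elim j₁ j₂)) {G : (ι → ι → ℝ) → ℝ} (hG : Measurable G)
    {C : ℝ} (hC : ∀ M, |G M| ≤ C) :
    ∫ r, G (r.block j₁) * G (r.block j₂) ∂D = (∫ r, G (r.block j₁) ∂D) ^ 2 := by
  cases nonempty_fintype ι
  let e : ι → ℕ := fun a => (Fintype.equivFin ι a : ℕ)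
  have he : Function.Injective e := fun a b hab =>
    (Fintype.equivFin ι).injective (Fin.val_injective hab)
  -- The pairing function supplies infinitely many pairwise disjoint copies of the index tuple.
  let J : ℕ → ι → ℕ := fun m a => Nat.pair m (e a)
  have hJ : ∀ m, Function.Injective (J m) := fun m a b hab =>
    he (Nat.pair_eq_pair.1 hab).2
  have hJJ : ∀ m l, m ≠ l → Function.Injective (Sum.elim (J m) (J l)) := fun m l hml =>
    Function.Injective.sumElim (hJ m) (hJ l) fun a b hab => hml (Nat.pair_eq_pair.1 hab).1
  have hm : ∀ j : ι → ℕ, Measurable fun r : DistanceMatrix => G (r.block j) := fun j =>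
    hG.comp (DistanceMatrix.measurable_block j)
  have hL : ∀ m, MemLp (fun r : DistanceMatrix => G (r.block (J m))) 2 D := fun m =>
    MemLp.of_bound (hm _).aestronglyMeasurable C (ae_of_all _ fun r => hC _)
  let y : ℕ → Lp ℝ 2 D := fun m => (hL m).toLp
  have hy : ∀ m, (y m : DistanceMatrix → ℝ) =ᵐ[D] fun r => G (r.block (J m)) :=
    fun m => (hL m).coeFn_toLp
  have hin : ∀ m l, inner ℝ (y m) (y l) = ∫ r, G (r.block (J m)) * G (r.block (J l)) ∂D := by
    intro m l
    rw [L2.inner_def]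
    refine integral_congr_ae ?_
    filter_upwards [hy m, hy l] with r h1 h2
    rw [h1, h2]
    simp [mul_comm]
  obtain ⟨V, hV, hVV⟩ := exists_tendsto_cesaro_of_gram (y := y)
    (β := ∫ r, G (r.block j₁) * G (r.block j₂) ∂D)
    (γ := ∫ r, G (r.block (J 0)) * G (r.block (J 0)) ∂D)
    (fun m => (hin m m).trans (integral_block_eq_of_injective D (hJ m) (hJ 0) fun M => G M * G M))
    (fun m l hml => (hin m l).trans
      (integral_block_mul_block_eq_of_injective D (hJJ m l hml) h G))
  have hinv : ∀ g : infiniteSymmetricGroup, (fun r => V (g • r)) =ᵐ[D] V := by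
    intro g
    have h1 : DomMulAct.mk g • V = V := by
      -- A finite permutation meets only finitely many of the tuples `J m`, so it fixes `y m` for
      -- all large `m`.
      obtain ⟨M, hM⟩ := ((inv_mem g.2 : _ ∈ infiniteSymmetricGroup).image
        fun i => (Nat.unpair i).1).bddAbove
      refine map_eq_of_tendsto_cesaro (M := M + 1) (fun v => DomMulAct.mk g • v)
        (isometry_smul _ _) ?_ ?_ hV
      · intro c s
        rw [smul_comm, Finset.smul_sum]
      · intro m hmM
        refine Lp.ext ?_
        have h2 := DomMulAct.smul_Lp_ae_eq (DomMulAct.mk g) (y m)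
        have h3 := (measurePreserving_smul g D).quasiMeasurePreserving.ae_eq_comp (hy m)
        filter_upwards [h2, h3, hy m] with r h2 h3 h4
        rw [h2, h4]
        simp only [Function.comp_apply] at h3
        simp only [Equiv.symm_apply_apply]
        rw [h3, DistanceMatrix.block_smul]
        congr 2
        funext a
        by_contra hne
        have := hM ⟨J m a, hne, rfl⟩
        simp [J] at this
        omega
    have h2 := DomMulAct.smul_Lp_ae_eq (DomMulAct.mk g) V
    rw [h1] at h2
    exact h2.symm
  obtain ⟨c, hc⟩ := ErgodicSMul.exists_ae_eq_const (Γ := infiniteSymmetricGroup)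
    (Lp.aestronglyMeasurable V) hinv
  -- Pairing the Cesàro means with the constant function `1` identifies the constant limit. Its
  -- squared norm `c ^ 2` is also the common inner product of distinct `y m`, which is the claim.
  have hmean : c = ∫ r, G (r.block j₁) ∂D := by
    have h1L : MemLp (fun _ : DistanceMatrix => (1 : ℝ)) 2 D := memLp_const 1
    let o : Lp ℝ 2 D := h1L.toLp
    have ho : (o : DistanceMatrix → ℝ) =ᵐ[D] fun _ => 1 := h1L.coeFn_toLp
    have hyo : ∀ m, inner ℝ o (y m) = ∫ r, G (r.block j₁) ∂D := by
      intro m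
      rw [L2.inner_def]
      trans ∫ r, G (r.block (J m)) ∂D
      · refine integral_congr_ae ?_
        filter_upwards [hy m, ho] with r h1 h2
        rw [h1, h2]
        simp
      · exact integral_block_eq_of_injective D (hJ m) (h.comp Sum.inl_injective) G
    have h2 : inner ℝ o V = c := by
      rw [L2.inner_def]
      trans ∫ r : DistanceMatrix, c ∂D
      · refine integral_congr_ae ?_
        filter_upwards [hc, ho] with r h1 h2
        rw [h1, h2]
        simp
      · simp
    rw [← h2]
    refine tendsto_nhds_unique (tendsto_const_nhds.inner hV) ?_
    refine tendsto_const_nhds.congr fun n => ?_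
    rw [real_inner_smul_right, inner_sum, Finset.sum_congr rfl fun m _ => hyo m]
    simp
    field_simp
  rw [← hVV, ← hmean, L2.inner_def]
  trans ∫ r : DistanceMatrix, c ^ 2 ∂D
  · refine integral_congr_ae ?_
    filter_upwards [hc] with r h1
    rw [h1]
    simp [sq]
  · simp

end Dissociated

/-! ### Variance and almost sure convergence of block averages. -/

section Averages

variable {ι : Type*} [Fintype ι] [DecidableEq ι]

/-- Non-injective tuples are an `O(1/n)` fraction of all tuples: such a tuple has a coincidence at
one of fewer than `|κ|²` ordered pairs, and each coincidence removes one free coordinate. -/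
theorem card_not_injective_mul_le (κ : Type*) [Fintype κ] [DecidableEq κ] (n : ℕ) :
    (Finset.univ.filter fun j : κ → Fin n => ¬ Function.Injective j).card * n
      ≤ Fintype.card κ ^ 2 * n ^ Fintype.card κ := by
  classical
  have hsub : (Finset.univ.filter fun j : κ → Fin n => ¬ Function.Injective j) ⊆
      (Finset.univ : Finset κ).offDiag.biUnion
        fun p => Finset.univ.filter fun j : κ → Fin n => j p.1 = j p.2 := by
    intro j hj
    simp only [Finset.mem_filter, Finset.mem_univ, true_and, Function.Injective, not_forall] at hj
    obtain ⟨a, b, hab, hne⟩ := hj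
    simp only [Finset.mem_biUnion, Finset.mem_filter, Finset.mem_univ, true_and]
    exact ⟨(a, b), by simpa using hne, hab⟩
  have hp : ∀ p ∈ (Finset.univ : Finset κ).offDiag,
      (Finset.univ.filter fun j : κ → Fin n => j p.1 = j p.2).card * n ≤ n ^ Fintype.card κ := by
    rintro ⟨a, b⟩ hp
    have hab : a ≠ b := by simpa using hp
    have : ((Finset.univ.filter fun j : κ → Fin n => j a = j b) ×ˢ
        (Finset.univ : Finset (Fin n))).card ≤ (Finset.univ : Finset (κ → Fin n)).card := by
      -- Overwriting coordinate `b` loses nothing, since its old value is still stored at `a`.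
      refine Finset.card_le_card_of_injOn (fun q => Function.update q.1 b q.2)
        (fun _ _ => Finset.mem_coe.2 (Finset.mem_univ _)) ?_
      rintro ⟨j, x⟩ hj ⟨j', x'⟩ hj' h
      simp only [Finset.coe_product, Set.mem_prod, Finset.mem_coe, Finset.mem_filter,
        Finset.mem_univ, true_and, and_true] at hj hj'
      have hx : x = x' := by simpa using congrFun h b
      have hne : ∀ i, i ≠ b → j i = j' i := fun i hi => by simpa [hi] using congrFun h i
      have : j = j' := by
        funext i
        by_cases hi : i = b
        · subst hi
          rw [← hj, ← hj', hne a hab]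
        · exact hne i hi
      rw [hx, this]
    simpa [Finset.card_product] using this
  calc _ ≤ ((Finset.univ : Finset κ).offDiag.biUnion
        fun p => Finset.univ.filter fun j : κ → Fin n => j p.1 = j p.2).card * n :=
        Nat.mul_le_mul_right _ (Finset.card_le_card hsub)
    _ ≤ (∑ p ∈ (Finset.univ : Finset κ).offDiag,
        (Finset.univ.filter fun j : κ → Fin n => j p.1 = j p.2).card) * n :=
        Nat.mul_le_mul_right _ Finset.card_biUnion_le
    _ ≤ ∑ p ∈ (Finset.univ : Finset κ).offDiag, n ^ Fintype.card κ := by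
        rw [Finset.sum_mul]; exact Finset.sum_le_sum hp
    _ ≤ _ := by
        rw [Finset.sum_const, smul_eq_mul, Finset.offDiag_card]
        refine Nat.mul_le_mul_right _ ?_
        rw [sq]
        exact Nat.sub_le _ _

/-- The average of a function of the submatrix along `j`, over all tuples `j` of indices less
than `n`. -/
noncomputable def DistanceMatrix.blockAverage (G : (ι → ι → ℝ) → ℝ) (n : ℕ) (r : DistanceMatrix) :
    ℝ :=
  ((n : ℝ) ^ Fintype.card ι)⁻¹ * ∑ j : ι → Fin n, G (r.block fun a => (j a : ℕ))

theorem DistanceMatrix.measurable_blockAverage {G : (ι → ι → ℝ) → ℝ} (hG : Measurable G) (n : ℕ) :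
    Measurable (DistanceMatrix.blockAverage G n) :=
  (Finset.measurable_sum _ fun _ _ => hG.comp (DistanceMatrix.measurable_block _)).const_mul _

theorem DistanceMatrix.abs_blockAverage_le {G : (ι → ι → ℝ) → ℝ} {C : ℝ} (hC : ∀ M, |G M| ≤ C)
    (n : ℕ) (r : DistanceMatrix) : |r.blockAverage G n| ≤ C := by
  have hC0 : 0 ≤ C := (abs_nonneg _).trans (hC fun _ _ => 0)
  rw [blockAverage, abs_mul, abs_of_nonneg (by positivity)]
  calc _ ≤ ((n : ℝ) ^ Fintype.card ι)⁻¹ * ((n : ℝ) ^ Fintype.card ι * C) := by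
        refine mul_le_mul_of_nonneg_left ?_ (by positivity)
        refine (Finset.abs_sum_le_sum_abs _ _).trans ?_
        refine (Finset.sum_le_sum fun j _ => hC _).trans ?_
        simp
    _ ≤ C := by
        rw [← mul_assoc]
        exact mul_le_of_le_one_left hC0 inv_mul_le_one

variable (D : Measure DistanceMatrix) [IsProbabilityMeasure D]
  [ErgodicSMul infiniteSymmetricGroup DistanceMatrix D]

/-- In the expanded square, pairs of disjoint injective tuples contribute zero by decorrelation and
centring; each remaining pair contributes at most `C ^ 2`, and these are the non-injective maps on
`ι ⊕ ι`. -/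
theorem integral_sq_sum_block_mul_le {G : (ι → ι → ℝ) → ℝ} (hG : Measurable G)
    {C : ℝ} (hC : ∀ M, |G M| ≤ C)
    (h0 : ∀ j : ι → ℕ, Function.Injective j → ∫ r, G (r.block j) ∂D = 0) (n : ℕ) :
    (∫ r, (∑ j : ι → Fin n, G (r.block fun a => (j a : ℕ))) ^ 2 ∂D) * n
      ≤ C ^ 2 * (2 * Fintype.card ι) ^ 2 * ((n : ℝ) ^ Fintype.card ι) ^ 2 := by
  have hm : ∀ j : ι → ℕ, Measurable fun r : DistanceMatrix => G (r.block j) := fun j =>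
    hG.comp (DistanceMatrix.measurable_block j)
  have hint : ∀ j j' : ι → ℕ, Integrable
      (fun r : DistanceMatrix => G (r.block j) * G (r.block j')) D := fun j j' => by
    refine Integrable.of_bound ((hm j).mul (hm j')).aestronglyMeasurable (C * C)
      (ae_of_all _ fun r => ?_)
    rw [Real.norm_eq_abs, abs_mul]
    exact mul_le_mul (hC _) (hC _) (abs_nonneg _) ((abs_nonneg _).trans (hC fun _ _ => 0))
  have hpair : ∀ q : ι ⊕ ι → Fin n,
      ∫ r, G (r.block fun a => (q (Sum.inl a) : ℕ)) * G (r.block fun a => (q (Sum.inr a) : ℕ)) ∂D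
        ≤ if ¬ Function.Injective q then C ^ 2 else 0 := by
    intro q
    by_cases hq : Function.Injective q
    swap
    · rw [if_pos hq]
      refine (integral_mono (hint _ _) (integrable_const (C ^ 2)) fun r => ?_).trans (by simp)
      refine (le_abs_self _).trans ?_
      rw [abs_mul, sq]
      exact mul_le_mul (hC _) (hC _) (abs_nonneg _) ((abs_nonneg _).trans (hC fun _ _ => 0))
    · rw [if_neg (not_not.2 hq)]
      have hq' : Function.Injective (Sum.elim (fun a => (q (Sum.inl a) : ℕ))
          fun a => (q (Sum.inr a) : ℕ)) := by
        have : (Sum.elim (fun a => (q (Sum.inl a) : ℕ)) fun a => (q (Sum.inr a) : ℕ))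
            = fun s => (q s : ℕ) := by
          funext s; cases s <;> rfl
        rw [this]
        exact Fin.val_injective.comp hq
      rw [integral_block_mul_block D hq' hG hC, h0 (fun a => (q (Sum.inl a) : ℕ))
        (hq'.comp Sum.inl_injective)]
      simp
  have hsum : ∫ r, (∑ j : ι → Fin n, G (r.block fun a => (j a : ℕ))) ^ 2 ∂D
      = ∑ q : ι ⊕ ι → Fin n, ∫ r, G (r.block fun a => (q (Sum.inl a) : ℕ)) *
          G (r.block fun a => (q (Sum.inr a) : ℕ)) ∂D := by
    simp_rw [sq, Finset.sum_mul_sum]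
    rw [integral_finsetSum _ fun i _ => integrable_finsetSum _ fun j _ => hint _ _]
    simp_rw [integral_finsetSum _ fun j _ => hint _ _]
    rw [← Finset.sum_product', Finset.univ_product_univ]
    refine Fintype.sum_equiv (Equiv.sumArrowEquivProdArrow ι ι (Fin n)).symm _ _ fun p => ?_
    rfl
  rw [hsum]
  have hcard := card_not_injective_mul_le (ι ⊕ ι) n
  calc _ ≤ (∑ q : ι ⊕ ι → Fin n, if ¬ Function.Injective q then C ^ 2 else 0) * (n : ℝ) := by
        gcongr with q _
        exact hpair q
    _ = C ^ 2 * (((Finset.univ.filter fun j : ι ⊕ ι → Fin n =>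
          ¬ Function.Injective j).card * n : ℕ) : ℝ) := by
        rw [← Finset.sum_filter, Finset.sum_const, nsmul_eq_mul]
        push_cast
        ring
    _ ≤ C ^ 2 * ((Fintype.card (ι ⊕ ι) ^ 2 * n ^ Fintype.card (ι ⊕ ι) : ℕ) : ℝ) := by
        gcongr
    _ = _ := by
        rw [Fintype.card_sum]
        push_cast
        ring

theorem integral_sq_blockAverage_sub_le {G : (ι → ι → ℝ) → ℝ} (hG : Measurable G)
    {C : ℝ} (hC : ∀ M, |G M| ≤ C) {c : ℝ}
    (hc : ∀ j : ι → ℕ, Function.Injective j → ∫ r, G (r.block j) ∂D = c) {n : ℕ} (hn : 0 < n) :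
    ∫ r, (r.blockAverage G n - c) ^ 2 ∂D
      ≤ (C + |c|) ^ 2 * (2 * Fintype.card ι) ^ 2 * (n : ℝ)⁻¹ := by
  have hC' : ∀ M, |G M - c| ≤ C + |c| := fun M => (abs_sub _ _).trans (by gcongr; exact hC M)
  have h := integral_sq_sum_block_mul_le D (hG.sub_const c) hC' (fun j hj => ?_) n
  · have hn' : (0 : ℝ) < n := by exact_mod_cast hn
    have hpos : (0 : ℝ) < (n : ℝ) ^ Fintype.card ι := by positivity
    have heq : ∀ r : DistanceMatrix, (r.blockAverage G n - c) ^ 2 =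
        (((n : ℝ) ^ Fintype.card ι) ^ 2)⁻¹ *
          (∑ j : ι → Fin n, (G (r.block fun a => (j a : ℕ)) - c)) ^ 2 := by
      intro r
      rw [Finset.sum_sub_distrib, DistanceMatrix.blockAverage]
      simp only [Finset.sum_const, Finset.card_univ, Fintype.card_fun, Fintype.card_fin,
        nsmul_eq_mul, Nat.cast_pow]
      field_simp
    simp_rw [heq]
    rw [integral_const_mul, ← div_eq_mul_inv, le_div_iff₀ hn', mul_assoc, inv_mul_le_iff₀ (by positivity)]
    linarith
  · rw [integral_sub _ (integrable_const _), hc j hj]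
    · simp
    · exact Integrable.of_bound (hG.comp (DistanceMatrix.measurable_block j)).aestronglyMeasurable C
        (ae_of_all _ fun r => hC _)

/-- Along squares, block averages of an ergodic random distance matrix converge almost surely. -/
theorem ae_tendsto_blockAverage {G : (ι → ι → ℝ) → ℝ} (hG : Measurable G)
    {C : ℝ} (hC : ∀ M, |G M| ≤ C) {c : ℝ}
    (hc : ∀ j : ι → ℕ, Function.Injective j → ∫ r, G (r.block j) ∂D = c) :
    ∀ᵐ r ∂D, Tendsto (fun m : ℕ => r.blockAverage G ((m + 1) ^ 2)) atTop (𝓝 c) := by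
  set K : ℝ := (C + |c|) ^ 2 * (2 * Fintype.card ι) ^ 2 with hK
  have hbd : ∀ (n : ℕ) (r : DistanceMatrix), |r.blockAverage G n| ≤ C := fun n r =>
    DistanceMatrix.abs_blockAverage_le hC n r
  have hmeas : ∀ n, Measurable fun r : DistanceMatrix => (r.blockAverage G n - c) ^ 2 := fun n =>
    ((DistanceMatrix.measurable_blockAverage hG n).sub_const c).pow_const 2
  -- The variance bound `K / n` is summable along `n = (m + 1) ^ 2`. Hence the sum of squared
  -- deviations is almost surely finite and its terms tend to zero.
  have hfin : ∫⁻ r, ∑' m : ℕ, ENNReal.ofReal ((r.blockAverage G ((m + 1) ^ 2) - c) ^ 2) ∂D ≠ ⊤ := by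
    rw [lintegral_tsum fun m => (hmeas _).ennreal_ofReal.aemeasurable]
    have hle : ∀ m : ℕ, ∫⁻ r, ENNReal.ofReal ((r.blockAverage G ((m + 1) ^ 2) - c) ^ 2) ∂D
        ≤ ENNReal.ofReal (K * (((m : ℝ) + 1) ^ 2)⁻¹) := by
      intro m
      rw [← ofReal_integral_eq_lintegral_ofReal _ (ae_of_all _ fun r => sq_nonneg _)]
      · refine ENNReal.ofReal_le_ofReal ?_
        have := integral_sq_blockAverage_sub_le D hG hC hc (n := (m + 1) ^ 2) (by positivity)
        simpa using this
      · refine Integrable.of_bound (hmeas _).aestronglyMeasurable ((C + |c|) ^ 2)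
          (ae_of_all _ fun r => ?_)
        rw [Real.norm_eq_abs, abs_pow]
        gcongr
        exact (abs_sub _ _).trans (by gcongr; exact hbd _ _)
    refine ne_top_of_le_ne_top ?_ (ENNReal.tsum_le_tsum hle)
    have hs : Summable fun m : ℕ => K * (((m : ℝ) + 1) ^ 2)⁻¹ := by
      refine Summable.mul_left _ ?_
      have := (summable_nat_add_iff 1).2 (Real.summable_nat_pow_inv (p := 2).2 one_lt_two)
      simpa using this
    rw [← ENNReal.ofReal_tsum_of_nonneg (fun m => by positivity) hs]
    exact ENNReal.ofReal_ne_top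
  filter_upwards [ae_lt_top' (AEMeasurable.tsum fun m =>
    (hmeas _).ennreal_ofReal.aemeasurable) hfin] with r hr
  have h1 := ENNReal.tendsto_atTop_zero_of_tsum_ne_top hr.ne
  have h2 := (ENNReal.tendsto_toReal ENNReal.zero_ne_top).comp h1
  simp only [Function.comp_def, ENNReal.toReal_zero, ENNReal.toReal_ofReal (sq_nonneg _)] at h2
  have h3 := h2.sqrt
  simp only [Real.sqrt_sq_eq_abs, Real.sqrt_zero] at h3
  rw [tendsto_iff_dist_tendsto_zero]
  simpa [Real.dist_eq] using h3

end Averages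

/-! ### Countably many tests that determine a law. -/

section TrigTest

/-- The finite set of row and column indices occurring in `J`. -/
def indexSupport (J : Finset (ℕ × ℕ)) : Finset ℕ := J.image Prod.fst ∪ J.image Prod.snd

theorem fst_mem_indexSupport {J : Finset (ℕ × ℕ)} {p : ℕ × ℕ} (h : p ∈ J) :
    p.1 ∈ indexSupport J :=
  Finset.mem_union_left _ (Finset.mem_image_of_mem _ h)

theorem snd_mem_indexSupport {J : Finset (ℕ × ℕ)} {p : ℕ × ℕ} (h : p ∈ J) :
    p.2 ∈ indexSupport J :=
  Finset.mem_union_right _ (Finset.mem_image_of_mem _ h)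

/-- The cosine (for `b = true`) or the sine of a rational linear combination of entries of a finite
matrix. -/
noncomputable def trigTest (J : Finset (ℕ × ℕ)) (q : J → ℚ) (b : Bool)
    (M : indexSupport J → indexSupport J → ℝ) : ℝ :=
  (bif b then Real.cos else Real.sin) (∑ p : J, (q p : ℝ) *
    M ⟨p.1.1, fst_mem_indexSupport p.2⟩ ⟨p.1.2, snd_mem_indexSupport p.2⟩)

theorem continuous_trigTest (J : Finset (ℕ × ℕ)) (q : J → ℚ) (b : Bool) :
    Continuous (trigTest J q b) := by
  have h : Continuous (bif b then Real.cos else Real.sin) := by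
    cases b
    · exact Real.continuous_sin
    · exact Real.continuous_cos
  refine h.comp (continuous_finsetSum _ fun p _ => continuous_const.mul ?_)
  exact continuous_apply_apply _ _

theorem abs_trigTest_le_one (J : Finset (ℕ × ℕ)) (q : J → ℚ) (b : Bool)
    (M : indexSupport J → indexSupport J → ℝ) : |trigTest J q b M| ≤ 1 := by
  cases b
  · exact Real.abs_sin_le_one _
  · exact Real.abs_cos_le_one _

/-- The family of all entries of a distance matrix. -/
def DistanceMatrix.entries (r : DistanceMatrix) (p : ℕ × ℕ) : ℝ := r.1 p.1 p.2

theorem DistanceMatrix.measurable_entries : Measurable DistanceMatrix.entries :=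
  measurable_pi_lambda _ fun _ => DistanceMatrix.measurable_entry _ _

theorem measure_eq_of_map_entries_eq {D D' : Measure DistanceMatrix}
    (h : D.map DistanceMatrix.entries = D'.map DistanceMatrix.entries) : D = D' := by
  refine Measure.ext fun S hS => ?_
  obtain ⟨T, hT, rfl⟩ := hS
  have hc : Measurable fun (f : ℕ × ℕ → ℝ) (i j : ℕ) => f (i, j) :=
    measurable_pi_lambda _ fun _ => measurable_pi_lambda _ fun _ => measurable_pi_apply _
  have := congrArg (fun μ => μ ((fun (f : ℕ × ℕ → ℝ) (i j : ℕ) => f (i, j)) ⁻¹' T)) h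
  simp only [Measure.map_apply DistanceMatrix.measurable_entries (hc hT)] at this
  exact this

theorem continuous_integral_exp_dotProduct {κ : Type*} [Fintype κ] (μ : Measure (κ → ℝ))
    [IsFiniteMeasure μ] :
    Continuous fun w : κ → ℝ => ∫ x, Complex.exp (((∑ p, w p * x p : ℝ) : ℂ) * Complex.I) ∂μ := by
  refine continuous_of_dominated (bound := fun _ => 1) (fun w => ?_) (fun w => ?_)
    (integrable_const _) (ae_of_all _ fun x => ?_)
  · exact Continuous.aestronglyMeasurable (by fun_prop)
  · exact ae_of_all _ fun x => (Complex.norm_exp_ofReal_mul_I _).le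
  · fun_prop

/-- Both characteristic functions are continuous and rational frequencies are dense. Countability is
what later allows one matrix to be typical for all tests at once. -/
theorem measure_eq_of_integral_exp_rat_eq {κ : Type*} [Fintype κ] {μ ν : Measure (κ → ℝ)}
    [IsFiniteMeasure μ] [IsFiniteMeasure ν]
    (h : ∀ q : κ → ℚ, ∫ x, Complex.exp (((∑ p, (q p : ℝ) * x p : ℝ) : ℂ) * Complex.I) ∂μ
      = ∫ x, Complex.exp (((∑ p, (q p : ℝ) * x p : ℝ) : ℂ) * Complex.I) ∂ν) : μ = ν := by
  classical
  have hd : DenseRange (fun (q : κ → ℚ) (p : κ) => (q p : ℝ)) :=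
    DenseRange.piMap fun _ => Rat.denseRange_cast
  have heq := hd.equalizer (continuous_integral_exp_dotProduct μ)
    (continuous_integral_exp_dotProduct ν) (funext h)
  refine Measure.ext_of_charFunDual (funext fun L => ?_)
  have hL : ∀ x : κ → ℝ, L x = ∑ p, L (Pi.single p 1) * x p := by
    intro x
    conv_lhs => rw [← Finset.univ_sum_single x, map_sum]
    refine Finset.sum_congr rfl fun p _ => ?_
    rw [mul_comm, ← smul_eq_mul, ← map_smul, ← Pi.single_smul, smul_eq_mul, mul_one]
  have hP : ∀ P : Measure (κ → ℝ), charFunDual P L = ∫ x, Complex.exp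
      (((∑ p, L (Pi.single p 1) * x p : ℝ) : ℂ) * Complex.I) ∂P := fun P => by
    rw [charFunDual_apply]
    congr 1
    funext x
    rw [← hL x]
  rw [hP, hP]
  exact congrFun heq fun p => L (Pi.single p 1)

theorem integral_exp_ofReal_mul_I {α : Type*} [MeasurableSpace α] {μ : Measure α}
    [IsFiniteMeasure μ] {f : α → ℝ} (hf : Measurable f) :
    ∫ x, Complex.exp ((f x : ℂ) * Complex.I) ∂μ
      = ((∫ x, Real.cos (f x) ∂μ : ℝ) : ℂ) + ((∫ x, Real.sin (f x) ∂μ : ℝ) : ℂ) * Complex.I := by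
  have hc : Integrable (fun x => ((Real.cos (f x) : ℝ) : ℂ)) μ :=
    (Integrable.of_bound (Real.measurable_cos.comp hf).aestronglyMeasurable 1
      (ae_of_all _ fun x => Real.abs_cos_le_one _)).ofReal
  have hs : Integrable (fun x => ((Real.sin (f x) : ℝ) : ℂ)) μ :=
    (Integrable.of_bound (Real.measurable_sin.comp hf).aestronglyMeasurable 1
      (ae_of_all _ fun x => Real.abs_sin_le_one _)).ofReal
  rw [← integral_complex_ofReal, ← integral_complex_ofReal, ← integral_mul_const, ← integral_add hc (hs.mul_const _)]
  refine integral_congr_ae (ae_of_all _ fun x => ?_)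
  simp only [Complex.exp_mul_I, Complex.ofReal_cos, Complex.ofReal_sin]

/-- A law on distance matrices is determined by the integrals of countably many trigonometric
functions of finite submatrices. -/
theorem measure_eq_of_integral_trigTest_eq {D D' : Measure DistanceMatrix}
    [IsProbabilityMeasure D] [IsProbabilityMeasure D']
    (h : ∀ (J : Finset (ℕ × ℕ)) (q : J → ℚ) (b : Bool),
      ∫ r, trigTest J q b (r.block Subtype.val) ∂D
        = ∫ r, trigTest J q b (r.block Subtype.val) ∂D') : D = D' := by
  apply measure_eq_of_map_entries_eq
  have hE := DistanceMatrix.measurable_entries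
  have : IsProbabilityMeasure (D.map DistanceMatrix.entries) :=
    Measure.isProbabilityMeasure_map hE.aemeasurable
  have : IsProbabilityMeasure (D'.map DistanceMatrix.entries) :=
    Measure.isProbabilityMeasure_map hE.aemeasurable
  -- A law on a countable product is determined by its finite-dimensional marginals.
  refine IsProjectiveLimit.unique
    (P := fun J : Finset (ℕ × ℕ) => (D'.map DistanceMatrix.entries).map J.restrict)
    (fun J => ?_) fun J => rfl
  have hJ : Measurable (J.restrict (π := fun _ : ℕ × ℕ => ℝ)) := Finset.measurable_restrict J
  have := Measure.isProbabilityMeasure_map (μ := D.map DistanceMatrix.entries) hJ.aemeasurable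
  have := Measure.isProbabilityMeasure_map (μ := D'.map DistanceMatrix.entries) hJ.aemeasurable
  refine measure_eq_of_integral_exp_rat_eq fun q => ?_
  have hexp : ∀ P : Measure DistanceMatrix, ∀ [IsProbabilityMeasure P],
      ∫ x, Complex.exp (((∑ p, (q p : ℝ) * x p : ℝ) : ℂ) * Complex.I)
        ∂((P.map DistanceMatrix.entries).map J.restrict)
      = ((∫ r, trigTest J q true (r.block Subtype.val) ∂P : ℝ) : ℂ)
        + ((∫ r, trigTest J q false (r.block Subtype.val) ∂P : ℝ) : ℂ) * Complex.I := by
    intro P _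
    rw [Measure.map_map hJ hE, integral_map (hJ.comp hE).aemeasurable
      (Continuous.aestronglyMeasurable (by fun_prop))]
    exact integral_exp_ofReal_mul_I
      (f := fun r => ∑ p : J, (q p : ℝ) * (J.restrict (DistanceMatrix.entries r)) p)
      (Finset.measurable_fun_sum _ fun p _ =>
        ((measurable_pi_apply p).comp (hJ.comp hE)).const_mul _)
  rw [hexp D, hexp D', h, h]

end TrigTest

/-! ### Empirical measures and their powers. -/

section Empirical

variable {X : Type*} [MeasurableSpace X]

/-- The uniform measure on the first `n` terms of a sequence. -/
noncomputable def empiricalMeasure (p : ℕ → X) (n : ℕ) [NeZero n] : ProbabilityMeasure X :=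
  ⟨(PMF.uniformOfFintype (Fin n)).toMeasure.map fun i : Fin n => p i,
    Measure.isProbabilityMeasure_map (measurable_of_finite _).aemeasurable⟩

theorem empiricalMeasure_apply (p : ℕ → X) (n : ℕ) [NeZero n] {S : Set X} (hS : MeasurableSet S)
    [DecidablePred (p · ∈ S)] :
    (empiricalMeasure p n : Measure X) S
      = ((Finset.range n).filter fun i => p i ∈ S).card / (n : ENNReal) := by
  classical
  change ((PMF.uniformOfFintype (Fin n)).toMeasure.map fun i : Fin n => p i) S = _
  rw [Measure.map_apply (measurable_of_finite _) hS,
    PMF.toMeasure_uniformOfFintype_apply _ (measurable_of_finite _ hS), Fintype.card_fin]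
  congr 2
  rw [Fintype.card_ofFinset]
  refine Finset.card_bij (fun i _ => (i : ℕ)) (fun i hi => ?_) (fun i _ i' _ h => Fin.ext h)
    fun i hi => ?_
  · simpa using hi
  · rw [Finset.mem_filter, Finset.mem_range] at hi
    exact ⟨⟨i, hi.1⟩, by simpa using hi.2, rfl⟩

/-- This is why block averages run over all tuples, repetitions included: they are then exactly
integrals against a product measure. -/
theorem integral_pi_empiricalMeasure {ι : Type*} [Fintype ι] [DecidableEq ι] (p : ℕ → X) (n : ℕ)
    [NeZero n] {f : (ι → X) → ℝ} (hf : Measurable f) :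
    ∫ x, f x ∂(ProbabilityMeasure.pi fun _ : ι => empiricalMeasure p n : Measure (ι → X))
      = ((n : ℝ) ^ Fintype.card ι)⁻¹ * ∑ j : ι → Fin n, f fun a => p (j a) := by
  have h := Measure.pi_map_pi (ι := ι) (μ := fun _ => (PMF.uniformOfFintype (Fin n)).toMeasure)
    (f := fun _ (i : Fin n) => p i) (hμ := fun _ =>
      have := Measure.isProbabilityMeasure_map (μ := (PMF.uniformOfFintype (Fin n)).toMeasure)
        (f := fun i : Fin n => p i) (measurable_of_finite _).aemeasurable
      inferInstance)
    (fun _ => (measurable_of_finite _).aemeasurable)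
  rw [ProbabilityMeasure.toMeasure_pi]
  change ∫ x, f x ∂(Measure.pi fun _ : ι =>
    (PMF.uniformOfFintype (Fin n)).toMeasure.map fun i : Fin n => p i) = _
  rw [← h, integral_map (measurable_of_finite _).aemeasurable hf.aestronglyMeasurable,
    integral_fintype Integrable.of_finite, Finset.mul_sum]
  refine Finset.sum_congr rfl fun j _ => ?_
  congr 1
  rw [Measure.real, Measure.pi_singleton]
  simp

end Empirical

/-! ### Tightness and accumulation of empirical measures. -/

section Tight

variable {X : Type*} [MetricSpace X] [CompleteSpace X] [MeasurableSpace X]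

/-- Intersecting finite unions of closed balls of radii tending to zero gives a closed totally
bounded set, compact by completeness; the lost masses are summable. -/
theorem isTightMeasureSet_of_finite_cover {S : Set (Measure X)}
    (h : ∀ ε : ℝ, 0 < ε → ∃ t : Set X, t.Finite ∧
      ∀ μ ∈ S, μ (⋃ x ∈ t, Metric.ball x ε)ᶜ ≤ ENNReal.ofReal ε) :
    IsTightMeasureSet S := by
  rw [isTightMeasureSet_iff_exists_isCompact_measure_compl_le]
  intro ε hε
  obtain ⟨δ, hδ, hδε⟩ := ENNReal.exists_pos_sum_of_countable hε.ne' ℕ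
  -- One parameter bounds both radius and lost mass, hence the minimum.
  have hpos : ∀ m : ℕ, 0 < min (δ m : ℝ) (1 / ((m : ℝ) + 1)) := fun m =>
    lt_min (NNReal.coe_pos.2 (hδ m)) (by positivity)
  choose t ht hS using fun m => h _ (hpos m)
  let A : ℕ → Set X := fun m => ⋃ x ∈ t m, Metric.closedBall x (1 / ((m : ℝ) + 1))
  have hA : ∀ m, IsClosed (A m) := fun m => (ht m).isClosed_biUnion fun x _ =>
    Metric.isClosed_closedBall
  refine ⟨⋂ m, A m, ?_, fun μ hμ => ?_⟩
  · refine TotallyBounded.isCompact_of_isClosed ?_ (isClosed_iInter hA)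
    rw [Metric.totallyBounded_iff]
    intro η hη
    obtain ⟨m, hm⟩ := exists_nat_one_div_lt hη
    refine ⟨t m, ht m, (Set.iInter_subset A m).trans ?_⟩
    exact Set.iUnion₂_mono fun x _ => Metric.closedBall_subset_ball hm
  · rw [Set.compl_iInter]
    refine (measure_iUnion_le _).trans (le_trans (ENNReal.tsum_le_tsum fun m => ?_) hδε.le)
    refine (measure_mono (Set.compl_subset_compl.2 (Set.iUnion₂_mono fun x _ => ?_))).trans
      ((hS m μ hμ).trans ?_)
    · exact (Metric.ball_subset_ball (min_le_right _ _)).trans Metric.ball_subset_closedBall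
    · rw [← ENNReal.ofReal_coe_nnreal]
      exact ENNReal.ofReal_le_ofReal (min_le_left _ _)

variable [BorelSpace X]

/-- Empirical measures that are asymptotically almost supported on small neighbourhoods of finitely
many terms of the sequence accumulate at some probability measure. -/
theorem exists_tendsto_empiricalMeasure (p : ℕ → X) (s : ℕ → ℕ) [∀ m, NeZero (s m)]
    (h : ∀ ε : ℝ, 0 < ε → ∃ N : ℕ, ∀ᶠ m in atTop,
      (empiricalMeasure p (s m) : Measure X) (⋃ i < N, Metric.ball (p i) ε)ᶜ ≤ ENNReal.ofReal ε) :
    ∃ (μ : ProbabilityMeasure X) (U : Ultrafilter ℕ), (U : Filter ℕ) ≤ atTop ∧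
      Tendsto (fun m => empiricalMeasure p (s m)) U (𝓝 μ) := by
  classical
  have ht : IsTightMeasureSet {((μ : ProbabilityMeasure X) : Measure X) |
      μ ∈ Set.range fun m => empiricalMeasure p (s m)} := by
    refine isTightMeasureSet_of_finite_cover fun ε hε => ?_
    obtain ⟨N, hN⟩ := h ε hε
    obtain ⟨m₀, hm₀⟩ := eventually_atTop.1 hN
    -- The bound holds only for `m ≥ m₀`; the added terms include every point charged by the
    -- finitely many earlier measures.
    let N' := N + ∑ m ∈ Finset.range m₀, s m
    refine ⟨p '' Set.Iio N', (Set.finite_Iio N').image p, ?_⟩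
    rintro _ ⟨_, ⟨m, rfl⟩, rfl⟩
    rw [Set.biUnion_image]
    by_cases hm : m₀ ≤ m
    · refine (measure_mono (Set.compl_subset_compl.2 ?_)).trans (hm₀ m hm)
      refine Set.biUnion_subset_biUnion_left fun i hi => ?_
      exact lt_of_lt_of_le hi (Nat.le_add_right _ _)
    · have hopen : IsOpen (⋃ i ∈ Set.Iio N', Metric.ball (p i) ε) :=
        isOpen_biUnion fun _ _ => Metric.isOpen_ball
      rw [empiricalMeasure_apply p (s m) hopen.measurableSet.compl, Finset.filter_false_of_mem]
      · simp
      · intro i hi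
        rw [Set.mem_compl_iff, not_not]
        refine Set.mem_biUnion (x := i) ?_ (Metric.mem_ball_self hε)
        have : s m ≤ ∑ m ∈ Finset.range m₀, s m :=
          Finset.single_le_sum (f := s) (fun _ _ => Nat.zero_le _)
            (Finset.mem_range.2 (not_le.1 hm))
        have := Finset.mem_range.1 hi
        change i < N + _
        omega
  have hc := isCompact_closure_of_isTightMeasureSet ht
  obtain ⟨μ, -, hμ⟩ := hc.exists_mapClusterPt (f := (atTop : Filter ℕ))
    (u := fun m => empiricalMeasure p (s m))
    (tendsto_principal.2 (Eventually.of_forall fun m => subset_closure (Set.mem_range_self m)))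
  rw [mapClusterPt_iff_ultrafilter] at hμ
  obtain ⟨U, hU, hUμ⟩ := hμ
  exact ⟨μ, U, hU, hUμ⟩

end Tight

theorem MetricTriple.isProbabilityMeasure_matrixDistribution (T : MetricTriple.{u}) :
    IsProbabilityMeasure T.matrixDistribution :=
  Measure.isProbabilityMeasure_map T.measurable_distMap.aemeasurable

theorem MetricTriple.integral_block_matrixDistribution (T : MetricTriple.{u}) (I : Finset ℕ)
    {G : (I → I → ℝ) → ℝ} (hG : Continuous G) :
    ∫ r, G (r.block Subtype.val) ∂T.matrixDistribution
      = ∫ x, G (fun a b => dist (x a) (x b)) ∂(Measure.pi fun _ : I => T.μ) := by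
  have : SecondCountableTopology T.X := UniformSpace.secondCountable_of_separable T.X
  have hc : Continuous fun x : I → T.X => G (fun a b => dist (x a) (x b)) :=
    hG.comp (continuous_pi fun a => continuous_pi fun b =>
      (continuous_apply a).dist (continuous_apply b))
  rw [← Measure.infinitePi_map_restrict (μ := fun _ : ℕ => T.μ),
    integral_map (Finset.measurable_restrict I).aemeasurable hc.aestronglyMeasurable,
    matrixDistribution, integral_map T.measurable_distMap.aemeasurable
      (f := fun r => G (r.block Subtype.val))
      (hG.measurable.comp (DistanceMatrix.measurable_block _)).aestronglyMeasurable]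
  rfl

/-- If the block averages of a distance matrix, realized by a sequence `p` of points, converge to
those of `D` and the empirical measures accumulate at `μ`, then `D` is the matrix distribution
of `μ`. -/
theorem matrixDistribution_eq_of_tendsto (T : MetricTriple.{u}) (D : Measure DistanceMatrix)
    [IsProbabilityMeasure D] (p : ℕ → T.X) (r : DistanceMatrix)
    (hr : ∀ i j, dist (p i) (p j) = r.1 i j) {U : Ultrafilter ℕ} (hU : (U : Filter ℕ) ≤ atTop)
    (hμ : Tendsto (fun m : ℕ => empiricalMeasure p ((m + 1) ^ 2)) U (𝓝 ⟨T.μ, T.prob⟩))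
    (h : ∀ (J : Finset (ℕ × ℕ)) (q : J → ℚ) (b : Bool),
      Tendsto (fun m : ℕ => r.blockAverage (trigTest J q b) ((m + 1) ^ 2)) atTop
        (𝓝 (∫ r, trigTest J q b (r.block Subtype.val) ∂D))) :
    T.matrixDistribution = D := by
  have : SecondCountableTopology T.X := UniformSpace.secondCountable_of_separable T.X
  have := T.isProbabilityMeasure_matrixDistribution
  refine measure_eq_of_integral_trigTest_eq fun J q b => ?_
  have hG := continuous_trigTest J q b
  rw [T.integral_block_matrixDistribution _ hG]
  let F : BoundedContinuousFunction (indexSupport J → T.X) ℝ :=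
    BoundedContinuousFunction.ofNormedAddCommGroup
      (fun x => trigTest J q b fun a b => dist (x a) (x b))
      (hG.comp (continuous_pi fun a => continuous_pi fun b =>
        (continuous_apply a).dist (continuous_apply b))) 1 fun x => abs_trigTest_le_one _ _ _ _
  have hF : ∀ x, F x = trigTest J q b fun a b => dist (x a) (x b) := fun x => rfl
  have h1 : Tendsto (fun m : ℕ => ProbabilityMeasure.pi fun _ : indexSupport J =>
      empiricalMeasure p ((m + 1) ^ 2)) U (𝓝 (ProbabilityMeasure.pi fun _ => ⟨T.μ, T.prob⟩)) :=
    (ProbabilityMeasure.continuous_pi.tendsto _).comp (tendsto_pi_nhds.2 fun _ => hμ)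
  have h2 := (ProbabilityMeasure.tendsto_iff_forall_integral_tendsto.1 h1) F
  refine tendsto_nhds_unique h2 (((h J q b).mono_left hU).congr fun m => ?_)
  rw [integral_pi_empiricalMeasure p _ F.continuous.measurable, DistanceMatrix.blockAverage]
  congr 1
  refine Finset.sum_congr rfl fun j _ => ?_
  rw [hF]
  congr 1
  funext a b
  exact (hr _ _).symm

/-! ### The completion of a distance matrix. -/

namespace DistanceMatrix

/-- The index set of a distance matrix, as a pseudometric space. -/
def Points (_r : DistanceMatrix) : Type u := ULift.{u} ℕ

instance (r : DistanceMatrix) : Countable (Points.{u} r) := inferInstanceAs (Countable (ULift ℕ))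

instance (r : DistanceMatrix) : PseudoMetricSpace (Points.{u} r) where
  dist i j := r.1 i.down j.down
  dist_self _ := r.2.1 _
  dist_comm _ _ := r.2.2.2.1 _ _
  dist_triangle _ _ _ := r.2.2.2.2 _ _ _

/-- The point with index `i`. -/
def Points.of (r : DistanceMatrix) (i : ℕ) : Points.{u} r := ULift.up i

theorem Points.surjective_of (r : DistanceMatrix) : Function.Surjective (Points.of.{u} r) :=
  ULift.up_surjective

/-- The completion of the index set of a distance matrix. -/
abbrev Space (r : DistanceMatrix) : Type u := UniformSpace.Completion (Points.{u} r)

/-- The point of the completion with index `i`. -/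
def point (r : DistanceMatrix) (i : ℕ) : Space.{u} r :=
  (Points.of.{u} r i : UniformSpace.Completion (Points.{u} r))

theorem dist_point (r : DistanceMatrix) (i j : ℕ) :
    dist (point.{u} r i) (point.{u} r j) = r.1 i j :=
  UniformSpace.Completion.dist_eq _ _

theorem denseRange_point (r : DistanceMatrix) : DenseRange (point.{u} r) :=
  (UniformSpace.Completion.denseRange_coe (α := Points.{u} r)).comp
    (Points.surjective_of.{u} r).denseRange (UniformSpace.Completion.continuous_coe _)

theorem compactSpace_space (r : DistanceMatrix)
    (h : ∀ ε : ℝ, 0 < ε → ∃ N : ℕ, ∀ j, ∃ i < N, r.1 i j < ε) : CompactSpace (Space.{u} r) := by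
  have ht : TotallyBounded (Set.range (point.{u} r)) := by
    rw [Metric.totallyBounded_iff]
    intro ε hε
    obtain ⟨N, hN⟩ := h ε hε
    refine ⟨point r '' Set.Iio N, (Set.finite_Iio N).image _, ?_⟩
    rintro _ ⟨j, rfl⟩
    obtain ⟨i, hi, hij⟩ := hN j
    rw [Set.biUnion_image]
    refine Set.mem_biUnion (x := i) hi ?_
    rw [Metric.mem_ball, dist_comm, dist_point]
    exact hij
  have hc := ht.closure
  rw [r.denseRange_point.closure_range] at hc
  exact ⟨hc.isCompact_of_isClosed isClosed_univ⟩

end DistanceMatrix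

/-! ### From covering in probability to almost sure covering. -/

section Covered

theorem coveredFraction_mono {ε ε' : ℝ} (h : ε ≤ ε') (N : ℕ) (r : DistanceMatrix) (n : ℕ) :
    coveredFraction ε N r n ≤ coveredFraction ε' N r n := by
  unfold coveredFraction
  gcongr with j hj

theorem coveredFraction_eq_one {ε : ℝ} (hε : 0 < ε) {N : ℕ} {r : DistanceMatrix}
    (h : ∀ j, N ≤ j → ∃ i < N, r.1 i j < ε) {n : ℕ} (hn : 0 < n) :
    coveredFraction ε N r n = 1 := by
  have hn' : (n : ℝ) ≠ 0 := by exact_mod_cast hn.ne'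
  unfold coveredFraction
  rw [Finset.filter_true_of_mem, Finset.card_range, div_self hn']
  intro j _
  by_cases hj : N ≤ j
  · exact h j hj
  · exact ⟨j, not_le.1 hj, by rw [r.2.1]; exact hε⟩

theorem measurable_coveredFraction (ε : ℝ) (N n : ℕ) :
    Measurable fun r => coveredFraction ε N r n := by
  classical
  unfold coveredFraction
  refine Measurable.div_const ?_ _
  simp_rw [Finset.card_filter]
  push_cast
  refine Finset.measurable_fun_sum _ fun j _ => Measurable.ite ?_ measurable_const measurable_const
  have : {r : DistanceMatrix | ∃ i < N, r.1 i j < ε} = ⋃ i < N, {r | r.1 i j < ε} := by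
    ext; simp
  rw [this]
  exact MeasurableSet.iUnion fun i => MeasurableSet.iUnion fun _ =>
    measurableSet_lt (DistanceMatrix.measurable_entry i j) measurable_const

theorem ae_mem_of_forall_one_sub_lt {α : Type*} [MeasurableSpace α] {μ : Measure α}
    [IsProbabilityMeasure μ] {B : Set α} (hB : MeasurableSet B)
    (h : ∀ δ : ℝ, 0 < δ → 1 - δ < μ.real B) : ∀ᵐ x ∂μ, x ∈ B := by
  have h1 : μ.real B = 1 := le_antisymm measureReal_le_one
    (le_of_forall_pos_le_add fun δ hδ => by linarith [h δ hδ])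
  change B ∈ ae μ
  rw [mem_ae_iff_prob_eq_one hB]
  simpa [Measure.real, ENNReal.toReal_eq_one_iff] using h1

theorem exists_forall_pos_of_nat {P : ℝ → Prop} (hP : ∀ ε ε', 0 < ε → ε ≤ ε' → P ε → P ε')
    (h : ∀ k : ℕ, P (1 / ((k : ℝ) + 1))) (ε : ℝ) (hε : 0 < ε) : P ε := by
  obtain ⟨k, hk⟩ := exists_nat_one_div_lt hε
  exact hP _ _ (by positivity) hk.le (h k)

variable {D : Measure DistanceMatrix} [IsProbabilityMeasure D]

theorem MostColumnsCovered.ae_eventually_coveredFraction (h : MostColumnsCovered D) :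
    ∀ᵐ r ∂D, ∀ ε : ℝ, 0 < ε → ∃ N : ℕ, ∀ᶠ n in atTop, 1 - ε < coveredFraction ε N r n := by
  have hk : ∀ᵐ r ∂D, ∀ k : ℕ, ∃ N : ℕ, ∀ᶠ n in atTop,
      1 - 1 / ((k : ℝ) + 1) < coveredFraction (1 / ((k : ℝ) + 1)) N r n := by
    refine ae_all_iff.2 fun k => ?_
    have hpos : (0 : ℝ) < 1 / ((k : ℝ) + 1) := by positivity
    generalize 1 / ((k : ℝ) + 1) = ε at hpos
    refine ae_mem_of_forall_one_sub_lt
      (B := {r | ∃ N : ℕ, ∀ᶠ n in atTop, 1 - ε < coveredFraction ε N r n}) ?_ fun δ hδ => ?_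
    · have : {r : DistanceMatrix | ∃ N : ℕ, ∀ᶠ n in atTop, 1 - ε < coveredFraction ε N r n}
          = ⋃ (N : ℕ) (m : ℕ), ⋂ (n : ℕ) (_ : m ≤ n), {r | 1 - ε < coveredFraction ε N r n} := by
        ext; simp [eventually_atTop]
      rw [this]
      exact MeasurableSet.iUnion fun N => MeasurableSet.iUnion fun m => MeasurableSet.iInter
        fun n => MeasurableSet.iInter fun _ =>
          measurableSet_lt measurable_const (measurable_coveredFraction ε N n)
    -- `δ` controls the probability and `ε` the covering scale; `N` may depend on `r`, so letting `δ
    -- → 0` at fixed `ε` gives probability one.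
    · obtain ⟨N, hN⟩ := h (min δ ε) (lt_min hδ hpos)
      refine lt_of_lt_of_le (lt_of_le_of_lt ?_ hN) (measureReal_mono ?_)
      · linarith [min_le_left δ ε]
      · rintro r ⟨L, hL, hLε⟩
        refine ⟨N, (hL.eventually (lt_mem_nhds hLε)).mono fun n hn => ?_⟩
        have := coveredFraction_mono (min_le_right δ ε) N r n
        linarith [min_le_right δ ε]
  filter_upwards [hk] with r hr
  refine exists_forall_pos_of_nat (fun ε ε' _ hεε' => ?_) hr
  rintro ⟨N, hN⟩
  refine ⟨N, hN.mono fun n hn => ?_⟩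
  linarith [coveredFraction_mono hεε' N r n]

theorem AllColumnsCovered.mostColumnsCovered (h : AllColumnsCovered D) : MostColumnsCovered D := by
  intro ε hε
  obtain ⟨N, hN⟩ := h ε hε
  refine ⟨N, hN.trans_le (measureReal_mono fun r hr => ⟨1, ?_, by linarith⟩)⟩
  refine tendsto_const_nhds.congr' ?_
  filter_upwards [eventually_gt_atTop 0] with n hn
  exact (coveredFraction_eq_one hε hr hn).symm

theorem AllColumnsCovered.ae_totallyBounded (h : AllColumnsCovered D) :
    ∀ᵐ r ∂D, ∀ ε : ℝ, 0 < ε → ∃ N : ℕ, ∀ j, ∃ i < N, r.1 i j < ε := by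
  have hk : ∀ᵐ (r : DistanceMatrix) ∂D, ∀ k : ℕ, ∃ N : ℕ, ∀ j,
      ∃ i < N, r.1 i j < 1 / ((k : ℝ) + 1) := by
    refine ae_all_iff.2 fun k => ?_
    have hpos : (0 : ℝ) < 1 / ((k : ℝ) + 1) := by positivity
    generalize 1 / ((k : ℝ) + 1) = ε at hpos
    refine ae_mem_of_forall_one_sub_lt
      (B := {r : DistanceMatrix | ∃ N : ℕ, ∀ j, ∃ i < N, r.1 i j < ε}) ?_ fun δ hδ => ?_
    · have : {r : DistanceMatrix | ∃ N : ℕ, ∀ j, ∃ i < N, r.1 i j < ε}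
          = ⋃ (N : ℕ), ⋂ (j : ℕ), ⋃ (i : ℕ) (_ : i < N),
            {r : DistanceMatrix | r.1 i j < ε} := by
        ext; simp
      rw [this]
      exact MeasurableSet.iUnion fun N => MeasurableSet.iInter fun j => MeasurableSet.iUnion
        fun i => MeasurableSet.iUnion fun _ =>
          measurableSet_lt (DistanceMatrix.measurable_entry i j) measurable_const
    · obtain ⟨N, hN⟩ := h (min δ ε) (lt_min hδ hpos)
      refine lt_of_lt_of_le (lt_of_le_of_lt ?_ hN) (measureReal_mono ?_)
      · linarith [min_le_left δ ε]
      · intro r hr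
        refine ⟨N, fun j => ?_⟩
        by_cases hj : N ≤ j
        · obtain ⟨i, hi, hij⟩ := hr j hj
          exact ⟨i, hi, hij.trans_le (min_le_right _ _)⟩
        · exact ⟨j, not_le.1 hj, by rw [r.2.1]; exact hpos⟩
  filter_upwards [hk] with r hr
  refine exists_forall_pos_of_nat (fun ε ε' _ hεε' => ?_) hr
  rintro ⟨N, hN⟩
  refine ⟨N, fun j => ?_⟩
  obtain ⟨i, hi, hij⟩ := hN j
  exact ⟨i, hi, hij.trans_le hεε'⟩

end Covered

/-! ### Reconstruction of a triple from a typical matrix. -/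

theorem empiricalMeasure_compl_iUnion_ball_le {X : Type*} [MetricSpace X] [MeasurableSpace X]
    [BorelSpace X] (p : ℕ → X) (r : DistanceMatrix) (hr : ∀ i j, dist (p i) (p j) = r.1 i j)
    {ε : ℝ} {N n : ℕ} [NeZero n] (h : 1 - ε < coveredFraction ε N r n) :
    (empiricalMeasure p n : Measure X) (⋃ i < N, Metric.ball (p i) ε)ᶜ ≤ ENNReal.ofReal ε := by
  classical
  have hm : MeasurableSet (⋃ i < N, Metric.ball (p i) ε) :=
    (isOpen_biUnion fun _ _ => Metric.isOpen_ball).measurableSet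
  have hn : (0 : ℝ) < n := by exact_mod_cast Nat.pos_of_neZero n
  have hcf : (empiricalMeasure p n : Measure X) (⋃ i < N, Metric.ball (p i) ε)
      = ENNReal.ofReal (coveredFraction ε N r n) := by
    rw [empiricalMeasure_apply p n hm, coveredFraction, ENNReal.ofReal_div_of_pos hn,
      ENNReal.ofReal_natCast, ENNReal.ofReal_natCast]
    congr 3
    ext j
    simp only [Finset.mem_filter, Set.mem_iUnion, Metric.mem_ball, exists_prop, and_congr_right_iff]
    intro _
    simp_rw [dist_comm (p j), hr]
  rw [prob_compl_eq_one_sub hm, hcf, ← ENNReal.ofReal_one,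
    ← ENNReal.ofReal_sub _ (by unfold coveredFraction; positivity)]
  exact ENNReal.ofReal_le_ofReal (by linarith)

theorem exists_metricTriple_of_mostColumnsCovered (D : Measure DistanceMatrix)
    [IsProbabilityMeasure D] [ErgodicSMul infiniteSymmetricGroup DistanceMatrix D]
    (h : MostColumnsCovered D) : ∃ T : MetricTriple.{u}, T.matrixDistribution = D ∧
      (AllColumnsCovered D → CompactSpace T.X) := by
  have h1 : ∀ᵐ r ∂D, ∀ (J : Finset (ℕ × ℕ)) (q : J → ℚ) (b : Bool),
      Tendsto (fun m : ℕ => r.blockAverage (trigTest J q b) ((m + 1) ^ 2)) atTop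
        (𝓝 (∫ r, trigTest J q b (r.block Subtype.val) ∂D)) := by
    refine ae_all_iff.2 fun J => ae_all_iff.2 fun q => ae_all_iff.2 fun b => ?_
    exact ae_tendsto_blockAverage D (continuous_trigTest J q b).measurable
      (abs_trigTest_le_one J q b)
      fun j hj => integral_block_eq_of_injective D hj Subtype.val_injective _
  -- Keeping the compactness hypothesis inside lets one choice of `r` serve both parts.
  have h2 : ∀ᵐ r ∂D, AllColumnsCovered D →
      ∀ ε : ℝ, 0 < ε → ∃ N : ℕ, ∀ j, ∃ i < N, r.1 i j < ε := by
    by_cases hD : AllColumnsCovered D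
    · filter_upwards [hD.ae_totallyBounded] with r hr _ using hr
    · exact ae_of_all _ fun _ hD' => absurd hD' hD
  obtain ⟨r, hr1, hr2, hr3⟩ := (h1.and (h2.and h.ae_eventually_coveredFraction)).exists
  let _ : MeasurableSpace (DistanceMatrix.Space.{u} r) := borel _
  have : BorelSpace (DistanceMatrix.Space.{u} r) := ⟨rfl⟩
  obtain ⟨μ, U, hU, hμ⟩ := exists_tendsto_empiricalMeasure (DistanceMatrix.point.{u} r)
    (fun m => (m + 1) ^ 2) fun ε hε => by
      obtain ⟨N, hN⟩ := hr3 ε hε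
      have hs : Tendsto (fun m : ℕ => (m + 1) ^ 2) atTop atTop :=
        tendsto_atTop_mono (fun m => show m ≤ (m + 1) ^ 2 by nlinarith) tendsto_id
      exact ⟨N, (hs.eventually hN).mono fun m hm =>
        empiricalMeasure_compl_iUnion_ball_le _ r (DistanceMatrix.dist_point r) hm⟩
  refine ⟨{ X := DistanceMatrix.Space.{u} r, μ := μ }, ?_, fun hD => ?_⟩
  · exact matrixDistribution_eq_of_tendsto { X := DistanceMatrix.Space.{u} r, μ := μ } D
      (DistanceMatrix.point.{u} r) r (DistanceMatrix.dist_point r) hU hμ hr1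
  · exact DistanceMatrix.compactSpace_space r (hr2 hD)

/-! ### Restriction to the support. -/

/-- A metric triple has the same matrix distribution as one with nondegenerate measure. -/
theorem MetricTriple.exists_isOpenPosMeasure (T : MetricTriple.{u}) :
    ∃ T' : MetricTriple.{u}, T'.μ.IsOpenPosMeasure ∧ T'.matrixDistribution = T.matrixDistribution ∧
      (CompactSpace T.X → CompactSpace T'.X) := by
  have : SecondCountableTopology T.X := UniformSpace.secondCountable_of_separable T.X
  have hcl : IsClosed T.μ.support := Measure.isClosed_support
  have hms : MeasurableSet T.μ.support := hcl.measurableSet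
  have hcs : CompleteSpace T.μ.support := hcl.completeSpace_coe
  have hmap : (T.μ.comap ((↑) : T.μ.support → T.X)).map (↑) = T.μ := by
    rw [map_comap_subtype_coe hms, Measure.restrict_eq_self_of_ae_mem]
    exact Measure.support_mem_ae
  have hprob : IsProbabilityMeasure (T.μ.comap ((↑) : T.μ.support → T.X)) := by
    refine ⟨?_⟩
    have := congrArg (fun ν => ν Set.univ) hmap
    rw [Measure.map_apply measurable_subtype_coe MeasurableSet.univ] at this
    simpa using this
  let T' : MetricTriple.{u} := { X := T.μ.support, μ := T.μ.comap (↑) }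
  refine ⟨T', ⟨fun U hU hne => ?_⟩, ?_, fun hc => ?_⟩
  · obtain ⟨V, hV, rfl⟩ := hU
    obtain ⟨x, hx⟩ := hne
    have h1 : T.μ V = (T.μ.comap ((↑) : T.μ.support → T.X)) ((↑) ⁻¹' V) := by
      rw [← Measure.map_apply measurable_subtype_coe hV.measurableSet, hmap]
    have h2 := (Measure.mem_support_iff_forall (x : T.X)).1 x.2 V (hV.mem_nhds hx)
    rw [h1] at h2
    exact h2.ne'
  · have hv : Measurable fun (x : ℕ → T.μ.support) (i : ℕ) => (x i : T.X) :=
      measurable_pi_lambda _ fun i => measurable_subtype_coe.comp (measurable_pi_apply i)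
    have h1 := Measure.infinitePi_map_pi (fun _ : ℕ => T.μ.comap ((↑) : T.μ.support → T.X))
      (f := fun _ => ((↑) : T.μ.support → T.X)) fun _ => measurable_subtype_coe
    simp only [hmap] at h1
    rw [matrixDistribution, matrixDistribution, ← h1, Measure.map_map T.measurable_distMap hv]
    rfl
  · exact isCompact_iff_compactSpace.1 hcl.isCompact

/-! ### Compact triples and independent sampling. -/

section Forward

theorem exists_forall_exists_dist_lt {X : Type*} [PseudoMetricSpace X] [CompactSpace X] (x : ℕ → X)
    {ε : ℝ} (hε : 0 < ε) : ∃ N : ℕ, ∀ j, ∃ i < N, dist (x i) (x j) < ε := by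
  obtain ⟨t, ht⟩ := (isClosed_closure (s := Set.range x)).isCompact.elim_finite_subcover
    (fun i => Metric.ball (x i) ε) (fun _ => Metric.isOpen_ball) fun y hy => by
      obtain ⟨_, ⟨i, rfl⟩, hi⟩ := Metric.mem_closure_iff.1 hy ε hε
      exact Set.mem_iUnion.2 ⟨i, hi⟩
  refine ⟨t.sup id + 1, fun j => ?_⟩
  obtain ⟨i, hi, hij⟩ := Set.mem_iUnion₂.1 (ht (subset_closure (Set.mem_range_self j)))
  refine ⟨i, Nat.lt_succ_of_le (Finset.le_sup (f := id) hi), ?_⟩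
  rw [dist_comm]
  exact hij

theorem exists_one_sub_lt_measureReal_of_monotone {α : Type*} [MeasurableSpace α] {μ : Measure α}
    [IsProbabilityMeasure μ] {B : ℕ → Set α} (hB : Monotone B) (h : ∀ᵐ x ∂μ, ∃ N, x ∈ B N)
    {ε : ℝ} (hε : 0 < ε) : ∃ N, 1 - ε < μ.real (B N) := by
  have h1 : μ (⋃ N, B N) = 1 := by
    rw [← measure_univ (μ := μ)]
    refine measure_congr ?_
    filter_upwards [h] with x hx
    exact propext (iff_true_intro (Set.mem_iUnion.2 hx))
  have h2 := (ENNReal.tendsto_toReal (by simp [h1])).comp (tendsto_measure_iUnion_atTop (μ := μ) hB)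
  rw [h1, ENNReal.toReal_one] at h2
  exact (h2.eventually (lt_mem_nhds (show 1 - ε < 1 by linarith))).exists

/-- An inequality valid for every `S` suffices for lower bounds and avoids proving the covering
events measurable. -/
theorem MetricTriple.measureReal_preimage_le (T : MetricTriple.{u}) (S : Set DistanceMatrix) :
    (Measure.infinitePi fun _ : ℕ => T.μ).real (T.distMap ⁻¹' S) ≤ T.matrixDistribution.real S := by
  have := T.isProbabilityMeasure_matrixDistribution
  exact ENNReal.toReal_mono (measure_ne_top _ _)
    (Measure.le_map_apply T.measurable_distMap.aemeasurable S)

theorem MetricTriple.allColumnsCovered (T : MetricTriple.{u}) [CompactSpace T.X] :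
    AllColumnsCovered T.matrixDistribution := by
  intro ε hε
  obtain ⟨N, hN⟩ := exists_one_sub_lt_measureReal_of_monotone
    (μ := Measure.infinitePi fun _ : ℕ => T.μ)
    (B := fun N => {x | ∀ j, ∃ i < N, dist (x i) (x j) < ε})
    (fun N M hNM x hx j => by
      obtain ⟨i, hi, hij⟩ := hx j
      exact ⟨i, hi.trans_le hNM, hij⟩)
    (ae_of_all _ fun x => exists_forall_exists_dist_lt x hε) hε
  refine ⟨N, hN.trans_le ((measureReal_mono fun x hx j _ => ?_).trans
    (T.measureReal_preimage_le _))⟩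
  exact hx j

variable {X : Type*} [MeasurableSpace X] (μ : Measure X) [IsProbabilityMeasure μ]

/-- The frequency of visits of an independent sequence to a set converges to its measure. -/
theorem ae_tendsto_frequency {S : Set X} (hS : MeasurableSet S) :
    ∀ᵐ x ∂(Measure.infinitePi fun _ : ℕ => μ),
      Tendsto (fun n : ℕ => (∑ j ∈ Finset.range n, S.indicator (fun _ => (1 : ℝ)) (x j)) / n)
        atTop (𝓝 (μ.real S)) := by
  have hm : Measurable (S.indicator fun _ : X => (1 : ℝ)) := measurable_const.indicator hS
  have hmi : ∀ i, Measurable fun x : ℕ → X => S.indicator (fun _ => (1 : ℝ)) (x i) := fun i =>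
    hm.comp (measurable_pi_apply i)
  have hmap : ∀ i, (Measure.infinitePi fun _ : ℕ => μ).map
      (fun x : ℕ → X => S.indicator (fun _ => (1 : ℝ)) (x i))
        = μ.map (S.indicator fun _ : X => (1 : ℝ)) := fun i => by
    have h := Measure.map_map hm (measurable_pi_apply (X := fun _ : ℕ => X) i)
      (μ := Measure.infinitePi fun _ : ℕ => μ)
    have h2 := Measure.infinitePi_map_eval (fun _ : ℕ => μ) i
    rw [show (fun x : ℕ → X => x i) = Function.eval i from rfl] at h2
    rw [show (fun x : ℕ → X => x i) = Function.eval i from rfl, h2] at h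
    exact h.symm
  have hint : Integrable (fun x : ℕ → X => S.indicator (fun _ => (1 : ℝ)) (x 0))
      (Measure.infinitePi fun _ : ℕ => μ) := by
    refine Integrable.of_bound (hmi 0).aestronglyMeasurable 1 (ae_of_all _ fun x => ?_)
    by_cases hx : x 0 ∈ S <;> simp [hx]
  have h := ProbabilityTheory.strong_law_ae_real
    (fun i (x : ℕ → X) => S.indicator (fun _ => (1 : ℝ)) (x i)) hint
    (fun i j hij => (ProbabilityTheory.iIndepFun_infinitePi (P := fun _ : ℕ => μ)
      (X := fun _ => S.indicator fun _ => (1 : ℝ)) fun _ => hm).indepFun hij)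
    (fun i => ⟨(hmi i).aemeasurable, (hmi 0).aemeasurable, (hmap i).trans (hmap 0).symm⟩)
  have hmean : ∫ x : ℕ → X, S.indicator (fun _ => (1 : ℝ)) (x 0)
      ∂(Measure.infinitePi fun _ : ℕ => μ) = μ.real S := by
    have h1 := integral_map (hmi 0).aemeasurable (μ := Measure.infinitePi fun _ : ℕ => μ)
      (f := fun t : ℝ => t) measurable_id.aestronglyMeasurable
    rw [← h1, hmap 0, integral_map (f := fun t : ℝ => t) hm.aemeasurable
      measurable_id.aestronglyMeasurable, integral_indicator_const _ hS]
    simp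
  rw [hmean] at h
  exact h

/-- Resampling the tail of an independent sequence does not change its law. -/
theorem map_prod_infinitePi_ite (N : ℕ) :
    ((Measure.infinitePi fun _ : ℕ => μ).prod (Measure.infinitePi fun _ : ℕ => μ)).map
      (fun (p : (ℕ → X) × (ℕ → X)) i => if i < N then p.1 i else p.2 i)
      = Measure.infinitePi fun _ : ℕ => μ := by
  have hm : Measurable fun (p : (ℕ → X) × (ℕ → X)) (i : ℕ) => if i < N then p.1 i else p.2 i := by
    refine measurable_pi_lambda _ fun i => ?_
    split_ifs
    · exact (measurable_pi_apply i).comp measurable_fst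
    · exact (measurable_pi_apply i).comp measurable_snd
  refine Measure.eq_infinitePi _ fun s t ht => ?_
  rw [Measure.map_apply hm (.pi s.countable_toSet fun _ _ => ht _)]
  have : (fun (p : (ℕ → X) × (ℕ → X)) i => if i < N then p.1 i else p.2 i) ⁻¹' (Set.pi s t)
      = (Set.pi (s.filter (· < N) : Finset ℕ) t) ×ˢ
        (Set.pi (s.filter (¬ · < N) : Finset ℕ) t) := by
    ext p
    simp only [Set.mem_preimage, Set.mem_pi, Set.mem_prod, Finset.coe_filter, Set.mem_ofPred_eq,
      Finset.mem_coe]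
    refine ⟨fun h => ⟨fun i hi => ?_, fun i hi => ?_⟩, fun h i hi => ?_⟩
    · simpa [hi.2] using h i hi.1
    · simpa [hi.2] using h i hi.1
    · split_ifs with hiN
      · exact h.1 i ⟨hi, hiN⟩
      · exact h.2 i ⟨hi, hiN⟩
  rw [this, Measure.prod_prod, Measure.infinitePi_pi _ fun _ _ => ht _,
    Measure.infinitePi_pi _ fun _ _ => ht _, Finset.prod_filter_mul_prod_filter_not]

end Forward

/-! ### Covering properties of independent sequences. -/

section Coverage

variable (T : MetricTriple.{u})

/-- The set of points within `ε` of one of the first `N` terms of a sequence. -/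
def MetricTriple.coveredSet (ε : ℝ) (N : ℕ) (x : ℕ → T.X) : Set T.X :=
  ⋃ i < N, Metric.ball (x i) ε

theorem MetricTriple.measurableSet_coveredSet (ε : ℝ) (N : ℕ) (x : ℕ → T.X) :
    MeasurableSet (T.coveredSet ε N x) :=
  (isOpen_biUnion fun _ _ => Metric.isOpen_ball).measurableSet

theorem MetricTriple.coveredSet_mono (ε : ℝ) (x : ℕ → T.X) :
    Monotone fun N => T.coveredSet ε N x := fun _ _ h =>
  Set.biUnion_subset_biUnion_left fun _ hi => lt_of_lt_of_le hi h

theorem MetricTriple.coveredFraction_distMap (ε : ℝ) (N : ℕ) (x : ℕ → T.X) (n : ℕ) :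
    coveredFraction ε N (T.distMap x) n
      = (∑ j ∈ Finset.range n, (T.coveredSet ε N x).indicator (fun _ => (1 : ℝ)) (x j)) / n := by
  classical
  unfold coveredFraction
  rw [Finset.card_filter]
  push_cast
  congr 1
  refine Finset.sum_congr rfl fun j _ => ?_
  rw [Set.indicator_apply]
  refine if_congr ?_ rfl rfl
  simp only [coveredSet, Set.mem_iUnion, Metric.mem_ball, exists_prop, dist_comm (x j)]
  rfl

theorem MetricTriple.measurable_measureReal_coveredSet (ε : ℝ) (N : ℕ) :
    Measurable fun x : ℕ → T.X => T.μ.real (T.coveredSet ε N x) := by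
  have : SecondCountableTopology T.X := UniformSpace.secondCountable_of_separable T.X
  have h : MeasurableSet {p : (ℕ → T.X) × T.X | p.2 ∈ T.coveredSet ε N p.1} := by
    have : {p : (ℕ → T.X) × T.X | p.2 ∈ T.coveredSet ε N p.1}
        = ⋃ i < N, {p : (ℕ → T.X) × T.X | dist p.2 (p.1 i) < ε} := by
      ext; simp [coveredSet]
    rw [this]
    exact MeasurableSet.iUnion fun i => MeasurableSet.iUnion fun _ => measurableSet_lt
      (measurable_snd.dist ((measurable_pi_apply i).comp measurable_fst)) measurable_const
  exact (measurable_measure_prodMk_left h).ennreal_toReal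

/-- The covered set is itself random, but depends only on the first `N` terms. Resampling takes head
and tail from independent sequences; with the head `y` fixed, the strong law applies to `z` and a
fixed set. -/
theorem MetricTriple.ae_tendsto_coveredFraction (ε : ℝ) (N : ℕ) :
    ∀ᵐ x ∂(Measure.infinitePi fun _ : ℕ => T.μ),
      Tendsto (coveredFraction ε N (T.distMap x)) atTop (𝓝 (T.μ.real (T.coveredSet ε N x))) := by
  have hQ : MeasurableSet {x : ℕ → T.X |
      Tendsto (coveredFraction ε N (T.distMap x)) atTop (𝓝 (T.μ.real (T.coveredSet ε N x)))} :=
    measurableSet_tendsto_fun (fun n => (measurable_coveredFraction ε N n).comp T.measurable_distMap)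
      (T.measurable_measureReal_coveredSet ε N)
  have hm : Measurable fun (p : (ℕ → T.X) × (ℕ → T.X)) (i : ℕ) =>
      if i < N then p.1 i else p.2 i := by
    refine measurable_pi_lambda _ fun i => ?_
    split_ifs
    · exact (measurable_pi_apply i).comp measurable_fst
    · exact (measurable_pi_apply i).comp measurable_snd
  rw [← map_prod_infinitePi_ite T.μ N, ae_map_iff hm.aemeasurable hQ]
  refine (Measure.ae_prod_iff_ae_ae (hm hQ)).2 ?_
  refine ae_of_all _ fun y => ?_
  filter_upwards [ae_tendsto_frequency T.μ (T.measurableSet_coveredSet ε N y)] with z hz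
  set w : ℕ → T.X := fun i => if i < N then y i else z i with hw
  have hS : T.coveredSet ε N w = T.coveredSet ε N y := by
    refine Set.iUnion₂_congr fun i hi => ?_
    simp [hw, hi]
  rw [hS]
  set S := T.coveredSet ε N y
  -- Replacing the first `N` terms of `z` changes the frequency by a fixed quantity over `n`.
  have h0 := tendsto_const_div_atTop_nhds_zero_nat (∑ j ∈ Finset.range N,
    (S.indicator (fun _ => (1 : ℝ)) (w j) - S.indicator (fun _ => (1 : ℝ)) (z j)))
  have h1 := hz.add h0
  rw [add_zero] at h1
  refine h1.congr' ?_
  filter_upwards [eventually_ge_atTop N] with n hn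
  rw [T.coveredFraction_distMap, hS, ← add_div]
  congr 1
  rw [Finset.sum_subset (Finset.range_mono hn), Finset.sum_sub_distrib]
  · ring
  · intro j _ hj
    rw [Finset.mem_range] at hj
    simp [hw, hj]

/-- A point never covered lies in a ball of radius `ε / 2` about a point of a countable dense set
that the sequence never visits. Almost surely such a ball has visiting frequency zero equal to its
measure, so these balls are null. -/
theorem MetricTriple.ae_measure_iUnion_coveredSet {ε : ℝ} (hε : 0 < ε) :
    ∀ᵐ x ∂(Measure.infinitePi fun _ : ℕ => T.μ), T.μ (⋃ N, T.coveredSet ε N x) = 1 := by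
  have hne : Nonempty T.X := nonempty_of_isProbabilityMeasure T.μ
  let d := TopologicalSpace.denseSeq T.X
  have hae : ∀ᵐ x ∂(Measure.infinitePi fun _ : ℕ => T.μ), ∀ k,
      Tendsto (fun n : ℕ => (∑ j ∈ Finset.range n,
        (Metric.ball (d k) (ε / 2)).indicator (fun _ => (1 : ℝ)) (x j)) / n)
          atTop (𝓝 (T.μ.real (Metric.ball (d k) (ε / 2)))) :=
    ae_all_iff.2 fun k => ae_tendsto_frequency T.μ Metric.isOpen_ball.measurableSet
  filter_upwards [hae] with x hx
  have hm : MeasurableSet (⋃ N, T.coveredSet ε N x) :=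
    MeasurableSet.iUnion fun N => T.measurableSet_coveredSet ε N x
  rw [← prob_compl_eq_zero_iff hm]
  have hcover : (⋃ N, T.coveredSet ε N x)ᶜ ⊆
      ⋃ k, ⋃ (_ : ∀ i, x i ∉ Metric.ball (d k) (ε / 2)), Metric.ball (d k) (ε / 2) := by
    intro y hy
    obtain ⟨k, hk⟩ := (TopologicalSpace.denseRange_denseSeq T.X).exists_dist_lt y (half_pos hε)
    refine Set.mem_iUnion₂.2 ⟨k, fun i hi => hy ?_, hk⟩
    refine Set.mem_iUnion.2 ⟨i + 1, Set.mem_iUnion₂.2 ⟨i, Nat.lt_succ_self i, ?_⟩⟩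
    rw [Metric.mem_ball] at hi ⊢
    have := dist_triangle_right y (x i) (d k)
    have hk' : dist y (d k) < ε / 2 := hk
    linarith
  refine measure_mono_null hcover (measure_iUnion_null fun k => measure_iUnion_null fun hk => ?_)
  have h1 := hx k
  have h2 : T.μ.real (Metric.ball (d k) (ε / 2)) = 0 := by
    refine tendsto_nhds_unique h1 (tendsto_const_nhds.congr fun n => ?_)
    rw [Finset.sum_eq_zero fun j _ => Set.indicator_of_notMem (hk j) _, zero_div]
  exact (measureReal_eq_zero_iff).1 h2

theorem MetricTriple.mostColumnsCovered : MostColumnsCovered T.matrixDistribution := by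
  intro ε hε
  have hmono : ∀ x, Monotone fun N => T.μ.real (T.coveredSet ε N x) := fun x N M h =>
    measureReal_mono (T.coveredSet_mono ε x h)
  obtain ⟨N, hN⟩ := exists_one_sub_lt_measureReal_of_monotone
    (μ := Measure.infinitePi fun _ : ℕ => T.μ)
    (B := fun N => {x | 1 - ε < T.μ.real (T.coveredSet ε N x)})
    (fun N M hNM x hx => lt_of_lt_of_le hx (hmono x hNM)) (by
      filter_upwards [T.ae_measure_iUnion_coveredSet hε] with x hx
      have h2 := (ENNReal.tendsto_toReal (by simp [hx])).comp
        (tendsto_measure_iUnion_atTop (μ := T.μ) (T.coveredSet_mono ε x))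
      rw [hx, ENNReal.toReal_one] at h2
      exact (h2.eventually (lt_mem_nhds (show 1 - ε < 1 by linarith))).exists) hε
  -- Intersecting with the almost sure event that the frequency converges supplies the existence of
  -- the limit.
  refine ⟨N, hN.trans_le (le_trans (le_of_eq ?_) ((measureReal_mono
    (s₁ := {x | 1 - ε < T.μ.real (T.coveredSet ε N x)} ∩ {x | Tendsto
      (coveredFraction ε N (T.distMap x)) atTop (𝓝 (T.μ.real (T.coveredSet ε N x)))})
    fun x hx => ?_).trans (T.measureReal_preimage_le _)))⟩
  · refine measureReal_congr ?_
    filter_upwards [T.ae_tendsto_coveredFraction ε N] with x hx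
    exact propext ⟨fun h => ⟨h, hx⟩, fun h => h.1⟩
  · exact ⟨_, hx.2, hx.1⟩

end Coverage

/-! ### The two characterizations. -/

theorem theorem7 (D : Measure DistanceMatrix) [IsProbabilityMeasure D]
    [ErgodicSMul infiniteSymmetricGroup DistanceMatrix D] :
    [∃ T : MetricTriple.{u}, T.matrixDistribution = D,
      ∃ T : MetricTriple.{u}, T.μ.IsOpenPosMeasure ∧ T.matrixDistribution = D,
      MostColumnsCovered D].TFAE ∧
    [∃ T : MetricTriple.{u}, CompactSpace T.X ∧ T.matrixDistribution = D,
      ∃ T : MetricTriple.{u}, CompactSpace T.X ∧ T.μ.IsOpenPosMeasure ∧ T.matrixDistribution = D,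
      AllColumnsCovered D].TFAE := by
  constructor
  · tfae_have 1 → 2 := by
      rintro ⟨T, rfl⟩
      obtain ⟨T', h1, h2, -⟩ := T.exists_isOpenPosMeasure
      exact ⟨T', h1, h2⟩
    tfae_have 2 → 3 := by
      rintro ⟨T, -, rfl⟩
      exact T.mostColumnsCovered
    tfae_have 3 → 1 := by
      intro h
      obtain ⟨T, hT, -⟩ := exists_metricTriple_of_mostColumnsCovered.{u} D h
      exact ⟨T, hT⟩
    tfae_finish
  · tfae_have 1 → 2 := by
      rintro ⟨T, hc, rfl⟩
      obtain ⟨T', h1, h2, h3⟩ := T.exists_isOpenPosMeasure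
      exact ⟨T', h3 hc, h1, h2⟩
    tfae_have 2 → 3 := by
      rintro ⟨T, hc, -, rfl⟩
      exact T.allColumnsCovered
    tfae_have 3 → 1 := by
      intro h
      obtain ⟨T, hT, hc⟩ := exists_metricTriple_of_mostColumnsCovered.{u} D h.mostColumnsCovered
      exact ⟨T, hc h, hT⟩
    tfae_finish
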